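/- Let $\mathfrak g$ be a finite-dimensional complex semisimple Lie algebra with a nondegenerate invariant symmetric bilinear form $(\cdot,\cdot)$, and let $h$ be its dual Coxeter number with respect to this form, i.e. the Casimir element $\sum_p c_p c_p$ ($\{c_p\}$ an orthonormal basis of $\mathfrak g$) acts on the adjoint module as the scalar $2h$. Let $\hat{\mathfrak g}=\mathfrak g\otimes\mathbb C[t,t^{-1}]\oplus\mathbb C\mathbf k$ be the affine Lie algebra with $\mathbf k$ central and $$[a\otimes t^m,b\otimes t^n]=[a,b]\otimes t^{m+n}+m(a,b)\delta_{m+n,0}\mathbf k,$$ and put $\hat{\mathfrak g}_{(\le 0)}=\mathfrak g\otimes\mathbb C[t]\oplus\mathbb C\mathbf k$ and $\hat{\mathfrak g}_{(-)}=\mathfrak g\otimes t\mathbb C[t]$. Let $\kappa\in\mathbb C\setminus\mathbb Q_{\ge 0}$ and $\ell=\kappa-h$. An object of $\mathcal O_\kappa$ is a $\hat{\mathfrak g}$-module that is a quotient of an induced module $U(\hat{\mathfrak g})\otimes_{U(\hat{\mathfrak g}_{(\le 0)})}M$, where $M$ is a finite-dimensional $\hat{\mathfrak g}_{(\le 0)}$-module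 on which $\mathbf k$ acts as $\ell$ and $\hat{\mathfrak g}_{(-)}$ acts nilpotently, and which is restricted: for all $a\in\mathfrak g$, $m\in M$ one has $(a\otimes t^n)m=0$ for $n$ sufficiently large. Let $V=V_{\hat{\mathfrak g}}(\ell,0)=U(\hat{\mathfrak g})\otimes_{U(\hat{\mathfrak g}_{(\le 0)})}\mathbb C$ be the affine vertex operator algebra of level $\ell$ ($\mathfrak g\otimes\mathbb C[t]$ acts on $\mathbb C$ as $0$ and $\mathbf k$ as $\ell$), with vacuum $\mathbf 1$ and conformal vector $\omega=\frac1{2(\ell+h)}\sum_p c_p(-1)c_p(-1)\mathbf 1$, where $a(n)$ denotes the action of $a\otimes t^n$. Every object $W$ of $\mathcal O_\kappa$ is a restricted $\hat{\mathfrak g}$-module of level $\ell$, hence a generalized $V$-module with vertex operators $Y_W(u,x)=\sum_{n\in\mathbb Z}u_nx^{-n-1}$ determined by $Y_W(a(-1)\mathbf 1,x)=\sum_{n\in\mathbb Z}a(n)x^{-n-1}$ for $a\in\mathfrak g$. Let $V_+=\coprod_{n>0}V_{(n)}$, where $V_{(n)}$ is the eigenspace of $L(0)=\omega_1$ on $V$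 with eigenvalue $n$, and let $C_1(W)$ be the linear span of all $u_{-1}w$ with $u\in V_+$ and $w\in W$. **Proposition.** Every object $W$ of $\mathcal O_\kappa$ is $C_1$-cofinite as a generalized $V_{\hat{\mathfrak g}}(\ell,0)$-module, i.e. $W/C_1(W)$ is finite-dimensional. -/

import Mathlib

open scoped TensorProduct

noncomputable section
namespace AffineVOA
universe u v w

attribute [local instance 100] LieRing.ofAssociativeRing

/-- A nondegenerate invariant symmetric bilinear form on a complex Lie algebra `𝔤`. -/
structure InvariantForm (𝔤 : Type u) [LieRing 𝔤] [LieAlgebra ℂ 𝔤] where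
  form : LinearMap.BilinForm ℂ 𝔤
  symm : form.IsSymm
  invariant : form.lieInvariant 𝔤
  nondegenerate : form.Nondegenerate

section fields
variable {W : Type w} [AddCommGroup W] [Module ℂ W]

open scoped VertexOperator

/-- The coefficient of `x₁ ^ (n - i) * x ^ i` in the expansion of `(x₁ - x) ^ n`. -/
def binCoeff (n : ℤ) (i : ℕ) : ℤ := (-1) ^ i * Ring.choose n i

theorem exists_trunc (A : VertexOperator ℂ W) (w : W) :
    ∃ N : ℤ, ∀ k, N ≤ k → (A[[k]]) w = 0 :=
  ⟨-(((HahnModule.of ℂ).symm (A w)).order), fun k hk =>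
    VertexOperator.ncoeff_eq_zero_of_lt_order A k w (by omega)⟩

theorem field_ext {A C : VertexOperator ℂ W} (h : ∀ k w, (A[[k]]) w = (C[[k]]) w) : A = C := by
  apply HVertexOperator.coeff_inj
  funext n
  ext w
  simpa using h (-n - 1) w

/-- The coefficient of `x ^ (-k - 1)` in `Res_{x₁} (x₁ - x) ^ n A(x₁) C(x) -
Res_{x₁} (-x + x₁) ^ n C(x) A(x₁)`, applied to `w`; both sums are finite. -/
def nthMode (A C : VertexOperator ℂ W) (n k : ℤ) (w : W) : W :=
  (∑ᶠ i : ℕ, binCoeff n i • (A[[n - i]]) ((C[[k + i]]) w)) -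
    ∑ᶠ i : ℕ, ((n.negOnePow : ℤ) * binCoeff n i) • (C[[n + k - i]]) ((A[[(i : ℤ)]]) w)

theorem nthMode_eq (A C : VertexOperator ℂ W) (n k : ℤ) (w : W) (P Q : ℕ)
    (hP : ∀ i : ℕ, P ≤ i → (C[[k + i]]) w = 0) (hQ : ∀ i : ℕ, Q ≤ i → (A[[(i : ℤ)]]) w = 0) :
    nthMode A C n k w =
      (∑ i ∈ Finset.range P, binCoeff n i • (A[[n - i]]) ((C[[k + i]]) w)) -
      ∑ i ∈ Finset.range Q,
        ((n.negOnePow : ℤ) * binCoeff n i) • (C[[n + k - i]]) ((A[[(i : ℤ)]]) w) := by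
  unfold nthMode
  congr 1
  · apply finsum_eq_sum_of_support_subset
    intro i hi
    by_contra h
    exact hi (by simp [hP i (by simpa using h)])
  · apply finsum_eq_sum_of_support_subset
    intro i hi
    by_contra h
    exact hi (by simp [hQ i (by simpa using h)])

theorem exists_trunc' (A : VertexOperator ℂ W) (w : W) (k : ℤ) :
    ∃ N : ℕ, ∀ i : ℤ, (N : ℤ) + k ≤ i → (A[[i]]) w = 0 := by
  obtain ⟨N, hN⟩ := exists_trunc A w
  exact ⟨(N - k).toNat, fun i hi => hN _ (by omega)⟩

theorem nthMode_lin (A C : VertexOperator ℂ W) (n k : ℤ) (r : ℂ) (v w : W) :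
    nthMode A C n k (r • v + w) = r • nthMode A C n k v + nthMode A C n k w := by
  obtain ⟨P, hP⟩ := exists_trunc' C v k
  obtain ⟨P', hP'⟩ := exists_trunc' C w k
  obtain ⟨Q, hQ⟩ := exists_trunc' A v 0
  obtain ⟨Q', hQ'⟩ := exists_trunc' A w 0
  have h1 : ∀ i : ℕ, max P P' ≤ i → (C[[k + i]]) v = 0 := fun i hi => hP _ (by omega)
  have h2 : ∀ i : ℕ, max P P' ≤ i → (C[[k + i]]) w = 0 := fun i hi => hP' _ (by omega)
  have h3 : ∀ i : ℕ, max Q Q' ≤ i → (A[[(i : ℤ)]]) v = 0 := fun i hi => hQ _ (by omega)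
  have h4 : ∀ i : ℕ, max Q Q' ≤ i → (A[[(i : ℤ)]]) w = 0 := fun i hi => hQ' _ (by omega)
  rw [nthMode_eq A C n k v _ _ h1 h3, nthMode_eq A C n k w _ _ h2 h4,
    nthMode_eq A C n k (r • v + w) _ _ (fun i hi => by simp [h1 i hi, h2 i hi])
      (fun i hi => by simp [h3 i hi, h4 i hi])]
  simp only [map_add, map_smul, smul_add, Finset.sum_add_distrib, smul_sub, Finset.smul_sum,
    smul_comm r]
  abel

/-- `nthMode` as an endomorphism of `W`. -/
def nthModeEnd (A C : VertexOperator ℂ W) (n k : ℤ) : Module.End ℂ W where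
  toFun := nthMode A C n k
  map_add' v w := by simpa using nthMode_lin A C n k 1 v w
  map_smul' r v := by
    have h0 : nthMode A C n k 0 = 0 := by simp [nthMode]
    simpa [h0] using nthMode_lin A C n k r v 0

theorem nthMode_trunc (A C : VertexOperator ℂ W) (n : ℤ) (w : W) :
    ∃ N : ℤ, ∀ k, N ≤ k → nthMode A C n k w = 0 := by
  obtain ⟨P, hP⟩ := exists_trunc C w
  obtain ⟨Q, hQ⟩ := exists_trunc' A w 0
  choose f hf using fun i : ℕ => exists_trunc C ((A[[(i : ℤ)]]) w)
  obtain ⟨M, hM⟩ := ((Finset.range Q).image fun i : ℕ => f i + i - n).bddAbove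
  refine ⟨max P M, fun k hk => ?_⟩
  rw [nthMode_eq A C n k w 0 Q (fun i _ => hP _ (by omega)) (fun i hi => hQ _ (by omega))]
  simp only [Finset.range_zero, Finset.sum_empty, zero_sub, neg_eq_zero]
  refine Finset.sum_eq_zero fun i hi => ?_
  have := hM (Finset.mem_coe.2 (Finset.mem_image_of_mem _ hi))
  rw [hf i _ (by omega), smul_zero]

/-- The `n`-th residue product
`Res_{x₁} (x₁ - x) ^ n A(x₁) C(x) - Res_{x₁} (-x + x₁) ^ n C(x) A(x₁)` of two vertex operators. -/
def nthProduct (A C : VertexOperator ℂ W) (n : ℤ) : VertexOperator ℂ W :=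
  VertexOperator.of_coeff (fun y => nthModeEnd A C n (-y - 1)) fun w => by
    obtain ⟨N, hN⟩ := nthMode_trunc A C n w
    refine ⟨-N, fun y hy => ?_⟩
    by_contra h
    exact hy (hN _ (by omega))

theorem nthProduct_ncoeff (A C : VertexOperator ℂ W) (n k : ℤ) (w : W) :
    ((nthProduct A C n)[[k]]) w = nthMode A C n k w := by
  rw [nthProduct, VertexOperator.ncoeff_of_coeff]
  simp [nthModeEnd]

theorem nthMode_linear_right (A C D : VertexOperator ℂ W) (r : ℂ) (n k : ℤ) (w : W) :
    nthMode A (r • C + D) n k w = r • nthMode A C n k w + nthMode A D n k w := by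
  obtain ⟨P, hP⟩ := exists_trunc' C w k
  obtain ⟨P', hP'⟩ := exists_trunc' D w k
  obtain ⟨Q, hQ⟩ := exists_trunc' A w 0
  have h1 : ∀ i : ℕ, max P P' ≤ i → (C[[k + i]]) w = 0 := fun i hi => hP _ (by omega)
  have h2 : ∀ i : ℕ, max P P' ≤ i → (D[[k + i]]) w = 0 := fun i hi => hP' _ (by omega)
  have h3 : ∀ i : ℕ, Q ≤ i → (A[[(i : ℤ)]]) w = 0 := fun i hi => hQ _ (by omega)
  rw [nthMode_eq A C n k w _ _ h1 h3, nthMode_eq A D n k w _ _ h2 h3,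
    nthMode_eq A _ n k w (max P P') Q (fun i hi => by simp [h1 i hi, h2 i hi]) h3]
  simp only [map_add, map_smul, Pi.add_apply, Pi.smul_apply, LinearMap.add_apply,
    LinearMap.smul_apply, smul_add, Finset.sum_add_distrib, smul_sub, Finset.smul_sum, smul_comm r]
  abel

theorem nthMode_linear_left (A A' C : VertexOperator ℂ W) (r : ℂ) (n k : ℤ) (w : W) :
    nthMode (r • A + A') C n k w = r • nthMode A C n k w + nthMode A' C n k w := by
  obtain ⟨P, hP⟩ := exists_trunc' C w k
  obtain ⟨Q, hQ⟩ := exists_trunc' A w 0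
  obtain ⟨Q', hQ'⟩ := exists_trunc' A' w 0
  have h1 : ∀ i : ℕ, P ≤ i → (C[[k + i]]) w = 0 := fun i hi => hP _ (by omega)
  have h3 : ∀ i : ℕ, max Q Q' ≤ i → (A[[(i : ℤ)]]) w = 0 := fun i hi => hQ _ (by omega)
  have h4 : ∀ i : ℕ, max Q Q' ≤ i → (A'[[(i : ℤ)]]) w = 0 := fun i hi => hQ' _ (by omega)
  rw [nthMode_eq A C n k w _ _ h1 h3, nthMode_eq A' C n k w _ _ h1 h4,
    nthMode_eq _ C n k w P (max Q Q') h1 (fun i hi => by simp [h3 i hi, h4 i hi])]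
  simp only [map_add, map_smul, Pi.add_apply, Pi.smul_apply, LinearMap.add_apply,
    LinearMap.smul_apply, smul_add, Finset.sum_add_distrib, smul_sub, Finset.smul_sum, smul_comm r]
  abel

/-- `nthProduct` as a bilinear map. -/
def nthProductHom (n : ℤ) :
    VertexOperator ℂ W →ₗ[ℂ] Module.End ℂ (VertexOperator ℂ W) :=
  LinearMap.mk₂ ℂ (fun A C => nthProduct A C n)
    (fun A A' C => field_ext fun k w => by
      simpa [nthProduct_ncoeff] using nthMode_linear_left A A' C 1 n k w)
    (fun r A C => field_ext fun k w => by
      have h0 : nthMode 0 C n k w = 0 := by simp [nthMode]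
      simpa [nthProduct_ncoeff, h0] using nthMode_linear_left A 0 C r n k w)
    (fun A C D => field_ext fun k w => by
      simpa [nthProduct_ncoeff] using nthMode_linear_right A C D 1 n k w)
    (fun r A C => field_ext fun k w => by
      have h0 : nthMode A 0 n k w = 0 := by simp [nthMode]
      simpa [nthProduct_ncoeff, h0] using nthMode_linear_right A C 0 r n k w)

theorem sum_square (P : ℕ) (F : ℕ → ℕ → W) (hF : ∀ i j, P ≤ i + j → F i j = 0) :
    ∑ i ∈ Finset.range P, ∑ j ∈ Finset.range P, F i j =
      ∑ s ∈ Finset.range P, ∑ p ∈ Finset.HasAntidiagonal.antidiagonal s, F p.1 p.2 := by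
  rw [← Finset.sum_product', Finset.sum_sigma']
  symm
  apply Finset.sum_of_injOn (fun x => x.2)
  · rintro ⟨s, i, j⟩ h ⟨s', i', j'⟩ h' heq
    simp at h h' heq
    obtain ⟨rfl, rfl⟩ := heq
    obtain ⟨_, rfl⟩ := h
    obtain ⟨_, rfl⟩ := h'
    rfl
  · rintro ⟨s, i, j⟩ h
    simp at h ⊢
    omega
  · rintro ⟨i, j⟩ h h'
    apply hF
    by_contra hlt
    exact h' ⟨⟨i + j, i, j⟩, by simp; omega, rfl⟩
  · simp

theorem sum_binCoeff (m n : ℤ) (s : ℕ) :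
    ∑ p ∈ Finset.HasAntidiagonal.antidiagonal s, binCoeff m p.1 * binCoeff n p.2 = binCoeff (m + n) s := by
  rw [binCoeff, Ring.add_choose_eq s (Commute.all m n), Finset.mul_sum]
  refine Finset.sum_congr rfl fun p hp => ?_
  rw [← Finset.HasAntidiagonal.mem_antidiagonal.1 hp, pow_add, binCoeff, binCoeff]
  ring

theorem sub_mul_choose (m : ℤ) (i : ℕ) :
    (m - i) * Ring.choose m i = m * Ring.choose (m - 1) i := by
  have h1 := Ring.choose_smul_choose m (Nat.le_succ i)
  have h2 := Ring.choose_smul_choose m (Nat.le_add_left 1 i)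
  simp only [Nat.succ_eq_add_one, Nat.add_sub_cancel_left, Nat.add_sub_cancel,
    Nat.choose_succ_self_right, Nat.choose_one_right, Ring.choose_one_right, Nat.cast_one] at h1 h2
  rw [← h2, h1, mul_comm]

theorem sum_binCoeff' (m n : ℤ) (s : ℕ) (h : m + n = s) :
    ∑ p ∈ Finset.HasAntidiagonal.antidiagonal s, binCoeff m p.1 * binCoeff n p.2 * (m - p.1) =
      if s = 0 then m else 0 := by
  have : ∀ p ∈ Finset.HasAntidiagonal.antidiagonal s, binCoeff m p.1 * binCoeff n p.2 * (m - p.1) =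
      m * (binCoeff (m - 1) p.1 * binCoeff n p.2) := fun p _ => by
    simp only [binCoeff]
    linear_combination (-1) ^ p.1 * ((-1) ^ p.2 * Ring.choose n p.2) * sub_mul_choose m p.1
  rw [Finset.sum_congr rfl this, ← Finset.mul_sum, sum_binCoeff, binCoeff]
  cases s with
  | zero => simp
  | succ s =>
    rw [show m - 1 + n = (s : ℤ) by push_cast at h; linarith, Ring.choose_natCast]
    simp

theorem nthMode_nthProduct (A A' C : VertexOperator ℂ W) (m n k : ℤ) (w : W) :
    ∃ P₀ : ℕ, ∀ P, P₀ ≤ P → nthMode A (nthProduct A' C n) m k w =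
      ((∑ i ∈ Finset.range P, ∑ j ∈ Finset.range P,
        (binCoeff m i * binCoeff n j) •
          (A[[m - i]]) ((A'[[n - j]]) ((C[[k + i + j]]) w))) -
      ∑ i ∈ Finset.range P, ∑ j ∈ Finset.range P,
        (binCoeff m i * ((n.negOnePow : ℤ) * binCoeff n j)) •
          (A[[m - i]]) ((C[[n + k + i - j]]) ((A'[[(j : ℤ)]]) w))) -
      ((∑ i ∈ Finset.range P, ∑ j ∈ Finset.range P,
        ((m.negOnePow : ℤ) * binCoeff m i * binCoeff n j) •
          (A'[[n - j]]) ((C[[m + k - i + j]]) ((A[[(i : ℤ)]]) w))) -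
      ∑ i ∈ Finset.range P, ∑ j ∈ Finset.range P,
        ((m.negOnePow : ℤ) * binCoeff m i * ((n.negOnePow : ℤ) * binCoeff n j)) •
          (C[[n + m + k - i - j]]) ((A'[[(j : ℤ)]]) ((A[[(i : ℤ)]]) w))) := by
  obtain ⟨Q, hQ⟩ := exists_trunc' A w 0
  obtain ⟨Q', hQ'⟩ := exists_trunc' A' w 0
  obtain ⟨R, hR⟩ := exists_trunc' C w k
  obtain ⟨S, hS⟩ := exists_trunc' (nthProduct A' C n) w k
  choose f hf using fun i : ℕ => exists_trunc' C ((A[[(i : ℤ)]]) w) (m + k - i)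
  choose g hg using fun i : ℕ => exists_trunc' A' ((A[[(i : ℤ)]]) w) 0
  refine ⟨Q + Q' + R + S + (∑ i ∈ Finset.range Q, f i) + ∑ i ∈ Finset.range Q, g i,
    fun P hP => ?_⟩
  have hfi : ∀ i ∈ Finset.range Q, f i ≤ P := fun i hi => by
    have := Finset.single_le_sum (f := f) (fun _ _ => Nat.zero_le _) hi; omega
  have hgi : ∀ i ∈ Finset.range Q, g i ≤ P := fun i hi => by
    have := Finset.single_le_sum (f := g) (fun _ _ => Nat.zero_le _) hi; omega
  rw [nthMode_eq A _ m k w P P (fun i hi => hS _ (by omega)) (fun i hi => hQ _ (by omega))]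
  simp only [nthProduct_ncoeff]
  congr 1
  · rw [← Finset.sum_sub_distrib]
    refine Finset.sum_congr rfl fun i hi => ?_
    rw [nthMode_eq A' C n (k + i) w P P (fun i hi => hR _ (by omega))
      (fun i hi => hQ' _ (by omega))]
    simp only [map_sub, map_sum, map_zsmul, smul_sub, Finset.smul_sum, smul_smul]
    simp only [← add_assoc]
  · rw [← Finset.sum_sub_distrib]
    refine Finset.sum_congr rfl fun i hi => ?_
    by_cases h : i < Q
    · have hi' := Finset.mem_range.2 h
      rw [nthMode_eq A' C n (m + k - i) _ P P
        (fun j hj => hf i _ (by have := hfi i hi'; omega))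
        (fun j hj => hg i _ (by have := hgi i hi'; omega))]
      simp only [map_sub, map_sum, map_zsmul, smul_sub, Finset.smul_sum, smul_smul]
      simp only [← add_assoc, ← add_sub_assoc]
    · have h0 : (A[[(i : ℤ)]]) w = 0 := hQ _ (by omega)
      simp [h0, nthMode]

theorem nthProduct_comm (A A' D C : VertexOperator ℂ W) (e : ℂ)
    (h : ∀ m n w, (A[[m]]) ((A'[[n]]) w) - (A'[[n]]) ((A[[m]]) w) =
      (D[[m + n]]) w + (if m + n = 0 then (m : ℂ) * e else 0) • w) (m n : ℤ) :
    nthProduct A (nthProduct A' C n) m - nthProduct A' (nthProduct A C m) n =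
      nthProduct D C (m + n) + (if m + n = 0 then (m : ℂ) * e else 0) • C := by
  apply field_ext
  intro k w
  obtain ⟨P₁, hP₁⟩ := nthMode_nthProduct A A' C m n k w
  obtain ⟨P₂, hP₂⟩ := nthMode_nthProduct A' A C n m k w
  obtain ⟨Q, hQ⟩ := exists_trunc' D w 0
  obtain ⟨R, hR⟩ := exists_trunc' C w k
  set P := P₁ + P₂ + Q + R + (m + n).toNat + 1 with hPdef
  have e1 := hP₁ P (by omega)
  have e2 := hP₂ P (by omega)
  have e3 := nthMode_eq D C (m + n) k w P P (fun i hi => hR _ (by omega))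
    (fun i hi => hQ _ (by omega))
  have c1 : ∑ i ∈ Finset.range P, ∑ j ∈ Finset.range P,
        (binCoeff m i * ((n.negOnePow : ℤ) * binCoeff n j)) •
          (A[[m - i]]) ((C[[n + k + i - j]]) ((A'[[(j : ℤ)]]) w)) =
      ∑ i ∈ Finset.range P, ∑ j ∈ Finset.range P,
        ((n.negOnePow : ℤ) * binCoeff n i * binCoeff m j) •
          (A[[m - j]]) ((C[[n + k - i + j]]) ((A'[[(i : ℤ)]]) w)) := by
    rw [Finset.sum_comm]
    refine Finset.sum_congr rfl fun i _ => Finset.sum_congr rfl fun j _ => ?_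
    rw [mul_comm, show n + k + j - i = n + k - i + j by ring]
  have c2 : ∑ i ∈ Finset.range P, ∑ j ∈ Finset.range P,
        (binCoeff n i * ((m.negOnePow : ℤ) * binCoeff m j)) •
          (A'[[n - i]]) ((C[[m + k + i - j]]) ((A[[(j : ℤ)]]) w)) =
      ∑ i ∈ Finset.range P, ∑ j ∈ Finset.range P,
        ((m.negOnePow : ℤ) * binCoeff m i * binCoeff n j) •
          (A'[[n - j]]) ((C[[m + k - i + j]]) ((A[[(i : ℤ)]]) w)) := by
    rw [Finset.sum_comm]
    refine Finset.sum_congr rfl fun i _ => Finset.sum_congr rfl fun j _ => ?_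
    rw [mul_comm, show m + k + j - i = m + k - i + j by ring]
  have c3 : (∑ i ∈ Finset.range P, ∑ j ∈ Finset.range P,
        (binCoeff m i * binCoeff n j) •
          (A[[m - i]]) ((A'[[n - j]]) ((C[[k + i + j]]) w))) -
      (∑ i ∈ Finset.range P, ∑ j ∈ Finset.range P,
        (binCoeff n i * binCoeff m j) •
          (A'[[n - i]]) ((A[[m - j]]) ((C[[k + i + j]]) w))) =
      (∑ i ∈ Finset.range P, binCoeff (m + n) i • (D[[m + n - i]]) ((C[[k + i]]) w)) +
        (if m + n = 0 then (m : ℂ) * e else 0) • (C[[k]]) w := by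
    rw [Finset.sum_comm (f := fun i j => (binCoeff n i * binCoeff m j) •
          (A'[[n - i]]) ((A[[m - j]]) ((C[[k + i + j]]) w))), ← Finset.sum_sub_distrib]
    simp only [← Finset.sum_sub_distrib]
    have step : ∀ i j : ℕ, (binCoeff m i * binCoeff n j) •
          (A[[m - i]]) ((A'[[n - j]]) ((C[[k + i + j]]) w)) - (binCoeff n j * binCoeff m i) •
          (A'[[n - j]]) ((A[[m - i]]) ((C[[k + j + i]]) w)) =
        (binCoeff m i * binCoeff n j) • ((D[[m + n - (i + j : ℕ)]]) ((C[[k + (i + j : ℕ)]]) w) +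
          (if m + n = (i + j : ℕ) then ((m - i : ℤ) : ℂ) * e else 0) •
            (C[[k + (i + j : ℕ)]]) w) := by
      intro i j
      rw [mul_comm (binCoeff n j), ← smul_sub, add_right_comm k (j : ℤ), h (m - i) (n - j),
        show m - (i : ℤ) + (n - j) = m + n - (i + j : ℕ) by push_cast; ring,
        show k + (i : ℤ) + j = k + (i + j : ℕ) by push_cast; ring]
      simp only [sub_eq_zero]
    simp only [step]
    rw [sum_square]
    · have inner : ∀ s ∈ Finset.range P, ∑ p ∈ Finset.HasAntidiagonal.antidiagonal s,
          (binCoeff m p.1 * binCoeff n p.2) •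
          ((D[[m + n - (p.1 + p.2 : ℕ)]]) ((C[[k + (p.1 + p.2 : ℕ)]]) w) +
          (if m + n = (p.1 + p.2 : ℕ) then ((m - p.1 : ℤ) : ℂ) * e else 0) •
            (C[[k + (p.1 + p.2 : ℕ)]]) w) =
          binCoeff (m + n) s • (D[[m + n - s]]) ((C[[k + s]]) w) +
            (if s = 0 then (if m + n = 0 then (m : ℂ) * e else 0) • (C[[k]]) w else 0) := by
        intro s _
        have : ∀ p ∈ Finset.HasAntidiagonal.antidiagonal s, (binCoeff m p.1 * binCoeff n p.2) •
          ((D[[m + n - (p.1 + p.2 : ℕ)]]) ((C[[k + (p.1 + p.2 : ℕ)]]) w) +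
          (if m + n = (p.1 + p.2 : ℕ) then ((m - p.1 : ℤ) : ℂ) * e else 0) •
            (C[[k + (p.1 + p.2 : ℕ)]]) w) =
          (binCoeff m p.1 * binCoeff n p.2) • (D[[m + n - s]]) ((C[[k + s]]) w) +
           (if m + n = s then (((binCoeff m p.1 * binCoeff n p.2 * (m - p.1) : ℤ) : ℂ) * e) else 0) •
             (C[[k + s]]) w := by
          intro p hp
          rw [Finset.HasAntidiagonal.mem_antidiagonal.1 hp, smul_add]
          congr 1
          split_ifs
          · rw [← Int.cast_smul_eq_zsmul ℂ, smul_smul]; push_cast; ring_nf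
          · simp
        rw [Finset.sum_congr rfl this, Finset.sum_add_distrib, ← Finset.sum_smul, sum_binCoeff,
          ← Finset.sum_smul]
        congr 1
        by_cases hs : m + n = s
        · simp only [hs, if_true]
          rw [← Finset.sum_mul, ← Int.cast_sum, sum_binCoeff' m n s hs]
          by_cases h0 : s = 0
          · subst h0; simp
          · simp [h0]
        · simp only [hs, if_false, Finset.sum_const_zero, zero_smul]
          by_cases h0 : s = 0
          · subst h0
            rw [if_pos rfl, if_neg (by simpa using hs), zero_smul]
          · simp [h0]
      rw [Finset.sum_congr rfl inner, Finset.sum_add_distrib]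
      congr 1
      rw [Finset.sum_ite_eq' (Finset.range P) 0]
      simp [hPdef]
    · intro i j hij
      rw [hR _ (by push_cast; omega)]
      simp
  have c4 : (∑ i ∈ Finset.range P, ∑ j ∈ Finset.range P,
        ((n.negOnePow : ℤ) * binCoeff n i * ((m.negOnePow : ℤ) * binCoeff m j)) •
          (C[[m + n + k - i - j]]) ((A[[(j : ℤ)]]) ((A'[[(i : ℤ)]]) w))) -
      (∑ i ∈ Finset.range P, ∑ j ∈ Finset.range P,
        ((m.negOnePow : ℤ) * binCoeff m i * ((n.negOnePow : ℤ) * binCoeff n j)) •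
          (C[[n + m + k - i - j]]) ((A'[[(j : ℤ)]]) ((A[[(i : ℤ)]]) w))) =
      ∑ i ∈ Finset.range P, (((m + n).negOnePow : ℤ) * binCoeff (m + n) i) •
        (C[[m + n + k - i]]) ((D[[(i : ℤ)]]) w) := by
    rw [Finset.sum_comm, ← Finset.sum_sub_distrib]
    simp only [← Finset.sum_sub_distrib]
    have step : ∀ i j : ℕ, 
        ((n.negOnePow : ℤ) * binCoeff n j * ((m.negOnePow : ℤ) * binCoeff m i)) •
          (C[[m + n + k - j - i]]) ((A[[(i : ℤ)]]) ((A'[[(j : ℤ)]]) w)) -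
        ((m.negOnePow : ℤ) * binCoeff m i * ((n.negOnePow : ℤ) * binCoeff n j)) •
          (C[[n + m + k - i - j]]) ((A'[[(j : ℤ)]]) ((A[[(i : ℤ)]]) w)) =
        (((m + n).negOnePow : ℤ) * (binCoeff m i * binCoeff n j)) •
          (C[[m + n + k - (i + j : ℕ)]]) ((D[[((i + j : ℕ) : ℤ)]]) w) := by
      intro i j
      have hh := h i j w
      have h0 : (if (i : ℤ) + j = 0 then ((i : ℤ) : ℂ) * e else 0) = 0 := by
        split_ifs with hz
        · have : i = 0 := by omega
          simp [this]
        · rfl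
      rw [h0, zero_smul, add_zero] at hh
      rw [show m + n + k - (j : ℤ) - i = m + n + k - (i + j : ℕ) by push_cast; ring,
        show n + m + k - (i : ℤ) - j = m + n + k - (i + j : ℕ) by push_cast; ring,
        mul_comm ((n.negOnePow : ℤ) * binCoeff n j), ← smul_sub, ← map_sub, hh, Int.negOnePow_add]
      push_cast
      congr 1
      ring
    simp only [step]
    rw [sum_square]
    · refine Finset.sum_congr rfl fun s _ => ?_
      rw [← sum_binCoeff, Finset.mul_sum, Finset.sum_smul]
      refine Finset.sum_congr rfl fun p hp => ?_
      rw [Finset.HasAntidiagonal.mem_antidiagonal.1 hp]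
    · intro i j hij
      rw [hQ _ (by push_cast; omega)]
      simp
  simp only [map_sub, map_add, map_smul, Pi.sub_apply, Pi.add_apply, Pi.smul_apply,
    LinearMap.sub_apply, LinearMap.add_apply, LinearMap.smul_apply, nthProduct_ncoeff]
  rw [e1, e2, e3, c1, c2, ← c4, sub_eq_iff_eq_add] 
  rw [sub_eq_iff_eq_add] at c3
  rw [c3]
  abel
end fields

section algebra
variable {𝔤 : Type u} [LieRing 𝔤] [LieAlgebra ℂ 𝔤]

theorem neg_form_invariant (B : InvariantForm 𝔤) : (-B.form).lieInvariant 𝔤 :=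
  fun x y z => by simp [B.invariant x y z]

theorem neg_form_symm (B : InvariantForm 𝔤) : (-B.form).IsSymm :=
  ⟨fun x y => by simp [B.symm.eq x y]⟩

/-- The cocycle `(a ⊗ t ^ m, b ⊗ t ^ n) ↦ m (a, b) δ_{m+n,0}` on `ℂ[t, t⁻¹] ⊗ 𝔤`. -/
def cocycle (B : InvariantForm 𝔤) :=
  LieAlgebra.LoopAlgebra.twoCocycleOfBilinear ℂ ℤ 𝔤 (-B.form)
    (neg_form_invariant B) (neg_form_symm B)

/-- The affine Lie algebra `𝔤̂ = 𝔤 ⊗ ℂ[t, t⁻¹] ⊕ ℂ𝐤`. -/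
def Alg (B : InvariantForm 𝔤) : Type u := LieAlgebra.ofTwoCocycle (cocycle B)

instance (B : InvariantForm 𝔤) : LieRing (Alg B) :=
  inferInstanceAs (LieRing (LieAlgebra.ofTwoCocycle (cocycle B)))

instance (B : InvariantForm 𝔤) : LieAlgebra ℂ (Alg B) :=
  inferInstanceAs (LieAlgebra ℂ (LieAlgebra.ofTwoCocycle (cocycle B)))

variable (B : InvariantForm 𝔤)

/-- The identification of the vector space `(ℂ[t, t⁻¹] ⊗ 𝔤) × ℂ` with `𝔤̂`. -/
def ofPair : (LieAlgebra.loopAlgebra ℂ ℤ 𝔤 × ℂ) ≃ₗ[ℂ] Alg B where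
  toFun p := LieAlgebra.ofProd (cocycle B) (p.1, (TrivialLieModule.equiv ℂ _ ℂ).symm p.2)
  invFun x := (((LieAlgebra.ofProd (cocycle B)).symm x).1,
    TrivialLieModule.equiv ℂ _ ℂ ((LieAlgebra.ofProd (cocycle B)).symm x).2)
  map_add' _ _ := rfl
  map_smul' _ _ := rfl
  left_inv _ := rfl
  right_inv _ := rfl

theorem lie_ofPair (p q : LieAlgebra.loopAlgebra ℂ ℤ 𝔤 × ℂ) :
    ⁅ofPair B p, ofPair B q⁆ = ofPair B (⁅p.1, q.1⁆,
      LieAlgebra.LoopAlgebra.residuePairing ℂ ℤ 𝔤 (-B.form) p.1 q.1) := by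
  apply (ofPair B).symm.injective
  rw [LinearEquiv.symm_apply_apply]
  refine Prod.ext rfl ?_
  change TrivialLieModule.equiv ℂ _ ℂ (_ + ⁅p.1, (_ : TrivialLieModule ℂ _ ℂ)⁆ -
    ⁅q.1, (_ : TrivialLieModule ℂ _ ℂ)⁆) = _
  rw [trivial_lie_zero, trivial_lie_zero, add_zero, sub_zero]
  rfl

/-- The element `a ⊗ t ^ n`. -/
def gen (n : ℤ) : 𝔤 →ₗ[ℂ] Alg B where
  toFun a := ofPair B (AddMonoidAlgebra.single n 1 ⊗ₜ[ℂ] a, 0)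
  map_add' a b := by rw [← map_add, Prod.mk_add_mk, TensorProduct.tmul_add, add_zero]
  map_smul' r a := by
    rw [RingHom.id_apply, ← map_smul, Prod.smul_mk, TensorProduct.tmul_smul, smul_zero]

/-- The central element `𝐤`. -/
def central : Alg B := ofPair B (0, 1)

/-- The coefficients in `𝔤` of the powers of `t`. -/
def loopPart : Alg B →ₗ[ℂ] (ℤ →₀ 𝔤) :=
  (LieAlgebra.LoopAlgebra.toFinsupp ℂ ℤ 𝔤).toLinearMap ∘ₗ LinearMap.fst ℂ _ ℂ ∘ₗ
    (ofPair B).symm.toLinearMap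

/-- The coefficient of `𝐤`. -/
def centralPart : Alg B →ₗ[ℂ] ℂ := LinearMap.snd ℂ _ ℂ ∘ₗ (ofPair B).symm.toLinearMap

@[simp] theorem loopPart_gen (n : ℤ) (a : 𝔤) : loopPart B (gen B n a) = Finsupp.single n a := by
  exact LieAlgebra.LoopAlgebra.toFinsupp_single_tmul ℂ ℤ 𝔤 n a
@[simp] theorem loopPart_central : loopPart B (central B) = 0 := by simp [loopPart, central]
@[simp] theorem centralPart_gen (n : ℤ) (a : 𝔤) : centralPart B (gen B n a) = 0 := by
  simp [centralPart, gen]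
@[simp] theorem centralPart_central : centralPart B (central B) = 1 := by
  simp [centralPart, central]

theorem eq_of_parts {x y : Alg B} (h : loopPart B x = loopPart B y)
    (h' : centralPart B x = centralPart B y) : x = y :=
  (ofPair B).symm.injective
    (Prod.ext ((LieAlgebra.LoopAlgebra.toFinsupp ℂ ℤ 𝔤).injective h) h')

theorem lie_gen_gen (a b : 𝔤) (m n : ℤ) :
    ⁅gen B m a, gen B n b⁆ =
      gen B (m + n) ⁅a, b⁆ + (if m + n = 0 then (m : ℂ) * B.form a b else 0) • central B := by
  change ⁅ofPair B (AddMonoidAlgebra.single m 1 ⊗ₜ[ℂ] a, 0),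
    ofPair B (AddMonoidAlgebra.single n 1 ⊗ₜ[ℂ] b, 0)⁆ =
    ofPair B (AddMonoidAlgebra.single (m + n) 1 ⊗ₜ[ℂ] ⁅a, b⁆, 0) + _ • ofPair B (0, 1)
  rw [lie_ofPair, ← map_smul, ← map_add]
  congr 1
  refine Prod.ext ?_ ?_
  · simp only [Prod.fst_add, Prod.smul_fst, smul_zero, add_zero]
    rw [LieAlgebra.ExtendScalars.bracket_tmul, AddMonoidAlgebra.single_mul_single, one_mul]
  · simp only [Prod.snd_add, Prod.smul_snd, zero_add, smul_eq_mul, mul_one]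
    rw [LieAlgebra.LoopAlgebra.residuePairing_apply_apply,
      LieAlgebra.LoopAlgebra.toFinsupp_single_tmul, LieAlgebra.LoopAlgebra.toFinsupp_single_tmul,
      Finsupp.sum_single_index (by simp), Finsupp.single_apply]
    split_ifs with h1 h2 h2
    · rw [show n = -m by omega, LinearMap.neg_apply, LinearMap.neg_apply, neg_smul, smul_neg,
        neg_neg, zsmul_eq_mul]
    · omega
    · omega
    · simp

theorem central_lie (x : Alg B) : ⁅central B, x⁆ = 0 := by
  obtain ⟨p, rfl⟩ := (ofPair B).surjective x
  rw [central, lie_ofPair]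
  refine (congrArg (ofPair B) (Prod.ext (zero_lie p.1) ?_)).trans (map_zero (ofPair B))
  exact LinearMap.congr_fun (map_zero _) p.1

theorem alg_induction {p : Alg B → Prop} (hg : ∀ n a, p (gen B n a)) (hc : p (central B))
    (hadd : ∀ x y, p x → p y → p (x + y)) (hsmul : ∀ (r : ℂ) x, p x → p (r • x))
    (x : Alg B) : p x := by
  have hx : x = (loopPart B x).sum (fun n a => gen B n a) + centralPart B x • central B := by
    apply eq_of_parts
    · rw [map_add, map_smul, loopPart_central, smul_zero, add_zero, Finsupp.sum, map_sum]
      simp only [loopPart_gen]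
      exact (Finsupp.sum_single _).symm
    · rw [map_add, map_smul, centralPart_central, Finsupp.sum, map_sum]
      simp
  rw [hx]
  refine hadd _ _ ?_ (hsmul _ _ hc)
  refine Finset.sum_induction _ p hadd ?_ (fun n _ => hg n _)
  simpa using hsmul 0 _ hc

/-- The subalgebra `𝔤̂_(≤0) = 𝔤 ⊗ ℂ[t] ⊕ ℂ𝐤`; here `a ⊗ t ^ n` has degree `-n`. -/
def nonpos : LieSubalgebra ℂ (Alg B) where
  toSubmodule := Submodule.span ℂ ({x | ∃ (n : ℕ) (a : 𝔤), x = gen B n a} ∪ {central B})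
  lie_mem' := by
    intro x y hx hy
    change x ∈ Submodule.span ℂ _ at hx
    change y ∈ Submodule.span ℂ _ at hy
    change _ ∈ Submodule.span ℂ _
    induction hx, hy using Submodule.span_induction₂ with
    | mem_mem x y hx hy =>
      rcases hx with ⟨m, a, rfl⟩ | rfl
      · rcases hy with ⟨n, b, rfl⟩ | rfl
        · rw [lie_gen_gen]
          refine add_mem (Submodule.subset_span (Or.inl ⟨m + n, ⁅a, b⁆, by push_cast; rfl⟩))
            (Submodule.smul_mem _ _ (Submodule.subset_span (Or.inr rfl)))
        · rw [← lie_skew, central_lie, neg_zero]; exact zero_mem _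
      · rw [central_lie]; exact zero_mem _
    | zero_left y _ => rw [zero_lie]; exact zero_mem _
    | zero_right x _ => rw [lie_zero]; exact zero_mem _
    | add_left x y z _ _ _ h1 h2 => rw [add_lie]; exact add_mem h1 h2
    | add_right x y z _ _ _ h1 h2 => rw [lie_add]; exact add_mem h1 h2
    | smul_left r x y _ _ h => rw [smul_lie]; exact Submodule.smul_mem _ _ h
    | smul_right r x y _ _ h => rw [lie_smul]; exact Submodule.smul_mem _ _ h

theorem gen_mem_nonpos (n : ℕ) (a : 𝔤) : gen B n a ∈ nonpos B :=
  Submodule.subset_span (Or.inl ⟨n, a, rfl⟩)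

theorem central_mem_nonpos : central B ∈ nonpos B := Submodule.subset_span (Or.inr rfl)

/-- `𝔤̂_(-) = 𝔤 ⊗ tℂ[t]`. -/
def negSubspace : Submodule ℂ (Alg B) := Submodule.span ℂ {x | ∃ (n : ℕ) (a : 𝔤), 0 < n ∧ x = gen B n a}

theorem centralPart_lie_nonpos (x y : Alg B) (hx : x ∈ nonpos B) (hy : y ∈ nonpos B) :
    centralPart B ⁅x, y⁆ = 0 := by
  change x ∈ Submodule.span ℂ _ at hx
  change y ∈ Submodule.span ℂ _ at hy
  induction hx, hy using Submodule.span_induction₂ with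
  | mem_mem x y hx hy =>
    rcases hx with ⟨m, a, rfl⟩ | rfl
    · rcases hy with ⟨n, b, rfl⟩ | rfl
      · rw [lie_gen_gen]
        rw [map_add, map_smul, centralPart_gen, zero_add]
        split_ifs with h
        · simp [show m = 0 by omega]
        · simp
      · rw [← lie_skew, central_lie, neg_zero, map_zero]
    · rw [central_lie, map_zero]
  | zero_left y _ => simp
  | zero_right x _ => simp
  | add_left x y z _ _ _ h1 h2 => simp [h1, h2]
  | add_right x y z _ _ _ h1 h2 => simp [h1, h2]
  | smul_left r x y _ _ h => simp [h]
  | smul_right r x y _ _ h => simp [h]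

end algebra

section induced
variable {L : Type u} [LieRing L] [LieAlgebra ℂ L] {H : LieSubalgebra ℂ L}
  {M : Type v} [AddCommGroup M] [Module ℂ M]

/-- The `U(L)`-submodule of `U(L) ⊗_ℂ M` generated by all `u h ⊗ m - u ⊗ h m`. -/
def balancing (ρ : H →ₗ⁅ℂ⁆ Module.End ℂ M) :
    Submodule (UniversalEnvelopingAlgebra ℂ L) (UniversalEnvelopingAlgebra ℂ L ⊗[ℂ] M) :=
  Submodule.span _ {y | ∃ (u : UniversalEnvelopingAlgebra ℂ L) (x : H) (m : M),
    y = (u * UniversalEnvelopingAlgebra.ι ℂ (x : L)) ⊗ₜ[ℂ] m - u ⊗ₜ[ℂ] ρ x m}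

/-- The induced module `U(L) ⊗_{U(H)} M`. -/
def Induced (ρ : H →ₗ⁅ℂ⁆ Module.End ℂ M) : Type (max u v) :=
  (UniversalEnvelopingAlgebra ℂ L ⊗[ℂ] M) ⧸ balancing ρ

variable (ρ : H →ₗ⁅ℂ⁆ Module.End ℂ M)

instance : AddCommGroup (Induced ρ) :=
  inferInstanceAs (AddCommGroup ((UniversalEnvelopingAlgebra ℂ L ⊗[ℂ] M) ⧸ balancing ρ))

instance : Module (UniversalEnvelopingAlgebra ℂ L) (Induced ρ) :=
  inferInstanceAs (Module (UniversalEnvelopingAlgebra ℂ L)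
    ((UniversalEnvelopingAlgebra ℂ L ⊗[ℂ] M) ⧸ balancing ρ))

instance : Module ℂ (Induced ρ) :=
  inferInstanceAs (Module ℂ ((UniversalEnvelopingAlgebra ℂ L ⊗[ℂ] M) ⧸ balancing ρ))

instance : IsScalarTower ℂ (UniversalEnvelopingAlgebra ℂ L) (Induced ρ) :=
  inferInstanceAs (IsScalarTower ℂ (UniversalEnvelopingAlgebra ℂ L)
    ((UniversalEnvelopingAlgebra ℂ L ⊗[ℂ] M) ⧸ balancing ρ))

instance : SMulCommClass ℂ (UniversalEnvelopingAlgebra ℂ L) (Induced ρ) :=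
  inferInstanceAs (SMulCommClass ℂ (UniversalEnvelopingAlgebra ℂ L)
    ((UniversalEnvelopingAlgebra ℂ L ⊗[ℂ] M) ⧸ balancing ρ))

instance : LieRingModule L (Induced ρ) where
  bracket x v := UniversalEnvelopingAlgebra.ι ℂ x • v
  add_lie x y v := by simp [add_smul]
  lie_add x v w := by simp [smul_add]
  leibniz_lie x y v := by
    change _ • _ • _ = _ • _ + _ • _ • _
    rw [LieHom.map_lie, LieRing.of_associative_ring_bracket]
    simp only [smul_smul, sub_smul]
    abel

theorem lie_def (x : L) (v : Induced ρ) : ⁅x, v⁆ = UniversalEnvelopingAlgebra.ι ℂ x • v := rfl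

instance : LieModule ℂ L (Induced ρ) where
  smul_lie r x v := by simp [lie_def]
  lie_smul r x v := by simp only [lie_def]; rw [smul_comm]

/-- The element `u ⊗ m` of the induced module. -/
def Induced.tmul (u : UniversalEnvelopingAlgebra ℂ L) (m : M) : Induced ρ :=
  Submodule.Quotient.mk (u ⊗ₜ[ℂ] m)

theorem Induced.smul_tmul (u u' : UniversalEnvelopingAlgebra ℂ L) (m : M) :
    u • Induced.tmul ρ u' m = Induced.tmul ρ (u * u') m := rfl

theorem Induced.tmul_zero (u : UniversalEnvelopingAlgebra ℂ L) : Induced.tmul ρ u 0 = 0 := by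
  rw [Induced.tmul, TensorProduct.tmul_zero]; rfl

theorem Induced.tmul_smul (u : UniversalEnvelopingAlgebra ℂ L) (r : ℂ) (m : M) :
    Induced.tmul ρ u (r • m) = r • Induced.tmul ρ u m := by
  rw [Induced.tmul, TensorProduct.tmul_smul]; rfl

theorem Induced.tmul_induction {p : Induced ρ → Prop} (ht : ∀ u m, p (Induced.tmul ρ u m))
    (hadd : ∀ v w, p v → p w → p (v + w)) (v : Induced ρ) : p v := by
  obtain ⟨z, rfl⟩ := Submodule.Quotient.mk_surjective _ v
  induction z using TensorProduct.induction_on with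
  | zero =>
    have := ht 0 0
    rwa [Induced.tmul_zero] at this
  | tmul u m => exact ht u m
  | add x y hx hy => exact hadd _ _ hx hy

theorem Induced.balanced (u : UniversalEnvelopingAlgebra ℂ L) (x : H) (m : M) :
    Induced.tmul ρ (u * UniversalEnvelopingAlgebra.ι ℂ (x : L)) m = Induced.tmul ρ u (ρ x m) :=
  (Submodule.Quotient.eq _).2 (Submodule.subset_span ⟨u, x, m, rfl⟩)

theorem uea_induction {p : UniversalEnvelopingAlgebra ℂ L → Prop}
    (hs : ∀ r : ℂ, p (algebraMap ℂ _ r)) (hι : ∀ x, p (UniversalEnvelopingAlgebra.ι ℂ x))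
    (hadd : ∀ x y, p x → p y → p (x + y)) (hmul : ∀ x y, p x → p y → p (x * y))
    (u : UniversalEnvelopingAlgebra ℂ L) : p u := by
  let S : Subalgebra ℂ (UniversalEnvelopingAlgebra ℂ L) :=
    { carrier := {u | p u}
      mul_mem' := fun {a b} => hmul a b
      add_mem' := fun {a b} => hadd a b
      algebraMap_mem' := hs }
  let f : L →ₗ⁅ℂ⁆ S :=
    { toFun := fun x => ⟨UniversalEnvelopingAlgebra.ι ℂ x, hι x⟩
      map_add' := fun x y => by ext; simp
      map_smul' := fun r x => by ext; simp
      map_lie' := fun {x y} => by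
        ext
        simp [LieRing.of_associative_ring_bracket] }
  have h : S.val.comp (UniversalEnvelopingAlgebra.lift ℂ f) = AlgHom.id ℂ _ := by
    ext x
    simp [f, -UniversalEnvelopingAlgebra.ι_apply, UniversalEnvelopingAlgebra.lift_ι_apply]
  have := (UniversalEnvelopingAlgebra.lift ℂ f u).2
  rwa [show ((UniversalEnvelopingAlgebra.lift ℂ f u : S) : UniversalEnvelopingAlgebra ℂ L) = u from
    congrArg (fun g => g u) h] at this

theorem Induced.induction {p : Induced ρ → Prop} (h1 : ∀ m, p (Induced.tmul ρ 1 m))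
    (hadd : ∀ v w, p v → p w → p (v + w)) (hsmul : ∀ (r : ℂ) v, p v → p (r • v))
    (hlie : ∀ (x : L) v, p v → p ⁅x, v⁆) (v : Induced ρ) : p v := by
  have hu : ∀ (u : UniversalEnvelopingAlgebra ℂ L) (v : Induced ρ), p v → p (u • v) := by
    intro u
    induction u using uea_induction with
    | hs r => intro v hv; rw [algebraMap_smul]; exact hsmul r v hv
    | hι x => exact hlie x
    | hadd x y hx hy => intro v hv; rw [add_smul]; exact hadd _ _ (hx v hv) (hy v hv)
    | hmul x y hx hy => intro v hv; rw [mul_smul]; exact hx _ (hy v hv)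
  induction v using Induced.tmul_induction with
  | ht u m =>
    have := hu u _ (h1 m)
    rwa [Induced.smul_tmul, mul_one] at this
  | hadd x y hx hy => exact hadd _ _ hx hy

/-- The linear map from the induced module, `u ⊗ m ↦ u · f m`, for an `L`-module `E` and an
`H`-map `f : M → E`. -/
def Induced.lift {E : Type w} [AddCommGroup E] [Module ℂ E] (Φ : L →ₗ⁅ℂ⁆ Module.End ℂ E)
    (f : M →ₗ[ℂ] E) (hf : ∀ (x : H) m, f (ρ x m) = Φ x (f m)) : Induced ρ →ₗ[ℂ] E :=
  let g : UniversalEnvelopingAlgebra ℂ L ⊗[ℂ] M →ₗ[ℂ] E :=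
    TensorProduct.lift ((LinearMap.lcomp ℂ E f).comp
      (UniversalEnvelopingAlgebra.lift ℂ Φ).toLinearMap)
  have hg : ∀ z ∈ balancing ρ, g z = 0 := by
    have key : ∀ (u : UniversalEnvelopingAlgebra ℂ L) z,
        g (u • z) = UniversalEnvelopingAlgebra.lift ℂ Φ u (g z) := by
      intro u z
      induction z using TensorProduct.induction_on with
      | zero => simp
      | tmul u' m => simp [g, TensorProduct.smul_tmul']
      | add x y hx hy => rw [smul_add, map_add, hx, hy, map_add, map_add]
    intro z hz
    induction hz using Submodule.span_induction with
    | mem z hz =>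
      obtain ⟨u, x, m, rfl⟩ := hz
      rw [map_sub, sub_eq_zero]
      simp [g, -UniversalEnvelopingAlgebra.ι_apply, UniversalEnvelopingAlgebra.lift_ι_apply, hf]
    | zero => simp
    | add x y _ _ hx hy => rw [map_add, hx, hy, add_zero]
    | smul u x _ hx => rw [key, hx, map_zero]
  (((balancing ρ).restrictScalars ℂ).liftQ g hg).comp
    (Submodule.Quotient.restrictScalarsEquiv ℂ (balancing ρ)).symm.toLinearMap

theorem Induced.lift_tmul {E : Type w} [AddCommGroup E] [Module ℂ E]
    (Φ : L →ₗ⁅ℂ⁆ Module.End ℂ E) (f : M →ₗ[ℂ] E) (hf : ∀ (x : H) m, f (ρ x m) = Φ x (f m))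
    (u : UniversalEnvelopingAlgebra ℂ L) (m : M) :
    Induced.lift ρ Φ f hf (Induced.tmul ρ u m) = UniversalEnvelopingAlgebra.lift ℂ Φ u (f m) := rfl

theorem Induced.lift_lie {E : Type w} [AddCommGroup E] [Module ℂ E]
    (Φ : L →ₗ⁅ℂ⁆ Module.End ℂ E) (f : M →ₗ[ℂ] E) (hf : ∀ (x : H) m, f (ρ x m) = Φ x (f m))
    (x : L) (v : Induced ρ) :
    Induced.lift ρ Φ f hf ⁅x, v⁆ = Φ x (Induced.lift ρ Φ f hf v) := by
  induction v using Induced.tmul_induction with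
  | ht u m =>
    rw [lie_def, Induced.smul_tmul, Induced.lift_tmul, Induced.lift_tmul, map_mul,
      UniversalEnvelopingAlgebra.lift_ι_apply]
    rfl
  | hadd y z hy hz => rw [lie_add, map_add, hy, hz, map_add, map_add]

end induced

section modules
variable {𝔤 : Type u} [LieRing 𝔤] [LieAlgebra ℂ 𝔤] (B : InvariantForm 𝔤)
variable (W : Type w) [AddCommGroup W] [Module ℂ W] [LieRingModule (Alg B) W]

/-- `𝐤` acts on `W` as the scalar `ℓ`. -/
def HasLevel (ℓ : ℂ) : Prop := ∀ v : W, ⁅central B, v⁆ = ℓ • v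

/-- `W` is restricted: `(a ⊗ t ^ n) v = 0` for `n` sufficiently large. -/
def IsRestricted : Prop := ∀ (a : 𝔤) (v : W), ∃ N : ℕ, ∀ n : ℕ, N ≤ n → ⁅gen B n a, v⁆ = 0

variable {W} [LieModule ℂ (Alg B) W]

/-- The vertex operator `a(x) = ∑ n, a(n) x ^ (-n - 1)` on a restricted module. -/
def currentField (hW : IsRestricted B W) : 𝔤 →ₗ[ℂ] VertexOperator ℂ W where
  toFun a := VertexOperator.of_coeff
    (fun y => LieModule.toEnd ℂ (Alg B) W (gen B (-y - 1) a)) fun v => by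
      obtain ⟨N, hN⟩ := hW a v
      refine ⟨-N, fun y hy => ?_⟩
      by_contra h
      refine hy ?_
      have := hN (-y - 1).toNat (by omega)
      rwa [Int.toNat_of_nonneg (by omega)] at this
  map_add' a b := field_ext fun k v => by simp [VertexOperator.ncoeff_of_coeff]
  map_smul' r a := field_ext fun k v => by simp [VertexOperator.ncoeff_of_coeff]

open scoped VertexOperator

theorem currentField_ncoeff (hW : IsRestricted B W) (a : 𝔤) (n : ℤ) (v : W) :
    ((currentField B hW a)[[n]]) v = ⁅gen B n a, v⁆ := by
  simp [currentField, VertexOperator.ncoeff_of_coeff]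

variable {B}

/-- `a ⊗ t ^ n` acts on `Hom(W, W((x)))` as the `n`-th residue product with `a(x)`, and `𝐤` acts
as `ℓ`. -/
def actionLin (hW : IsRestricted B W) (ℓ : ℂ) :
    Alg B →ₗ[ℂ] Module.End ℂ (VertexOperator ℂ W) :=
  (Finsupp.lsum ℂ fun n : ℤ => (nthProductHom n).comp (currentField B hW)).comp (loopPart B) +
    (ℓ • centralPart B).smulRight 1

theorem actionLin_gen (hW : IsRestricted B W) (ℓ : ℂ) (n : ℤ) (a : 𝔤) (C : VertexOperator ℂ W) :
    actionLin hW ℓ (gen B n a) C = nthProduct (currentField B hW a) C n := by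
  simp [actionLin, nthProductHom]

theorem actionLin_central (hW : IsRestricted B W) (ℓ : ℂ) (C : VertexOperator ℂ W) :
    actionLin hW ℓ (central B) C = ℓ • C := by
  simp [actionLin]

theorem lie_of_gen {E : Type v} [AddCommGroup E] [Module ℂ E] (φ : Alg B →ₗ[ℂ] Module.End ℂ E)
    (ℓ : ℂ) (hc : ∀ v, φ (central B) v = ℓ • v)
    (hg : ∀ m n a b v, φ (gen B m a) (φ (gen B n b) v) - φ (gen B n b) (φ (gen B m a) v) =
      φ (gen B (m + n) ⁅a, b⁆) v + (if m + n = 0 then (m : ℂ) * (B.form a b * ℓ) else 0) • v)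
    (x y : Alg B) (v : E) : φ ⁅x, y⁆ v = φ x (φ y v) - φ y (φ x v) := by
  induction x using alg_induction with
  | hc => simp [central_lie, hc]
  | hadd x x' h h' => simp only [add_lie, map_add, LinearMap.add_apply, h, h']; abel
  | hsmul r x h => simp only [smul_lie, map_smul, LinearMap.smul_apply, h, smul_sub]
  | hg m a =>
    induction y using alg_induction with
    | hc => rw [← lie_skew, central_lie]; simp [hc]
    | hadd x x' h h' => simp only [lie_add, map_add, LinearMap.add_apply, h, h']; abel
    | hsmul r x h => simp only [lie_smul, map_smul, LinearMap.smul_apply, h, smul_sub]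
    | hg n b =>
      rw [lie_gen_gen, map_add, map_smul, hg, LinearMap.add_apply, LinearMap.smul_apply, hc,
        smul_smul]
      congr 2
      split_ifs <;> ring

/-- The representation of `𝔤̂` on `Hom(W, W((x)))` given by `actionLin`. -/
def action (hW : IsRestricted B W) {ℓ : ℂ} (hℓ : HasLevel B W ℓ) :
    Alg B →ₗ⁅ℂ⁆ Module.End ℂ (VertexOperator ℂ W) :=
  { actionLin hW ℓ with
    map_lie' := fun {x y} => LinearMap.ext fun C =>
      lie_of_gen (actionLin hW ℓ) ℓ (actionLin_central hW ℓ) (fun m n a b C => by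
        simp only [actionLin_gen]
        refine nthProduct_comm (currentField B hW a) (currentField B hW b) (currentField B hW ⁅a, b⁆) C
          (B.form a b * ℓ) (fun m n w => ?_) m n
        simp only [currentField_ncoeff]
        rw [← lie_lie, lie_gen_gen, add_lie, smul_lie, hℓ, smul_smul]
        congr 2
        split_ifs <;> ring) x y C }

variable (B) in
/-- The `𝔤̂_(≤0)`-module `ℂ`: `𝔤 ⊗ ℂ[t]` acts as `0` and `𝐤` as `ℓ`. -/
def trivialRep (ℓ : ℂ) : nonpos B →ₗ⁅ℂ⁆ Module.End ℂ ℂ where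
  toFun x := (ℓ * centralPart B x) • 1
  map_add' x y := by simp [mul_add, add_smul]
  map_smul' r x := by simp [smul_smul, mul_left_comm]
  map_lie' := by
    intro x y
    rw [LieSubalgebra.coe_bracket, centralPart_lie_nonpos B _ _ x.2 y.2, mul_zero, zero_smul]
    exact (sub_eq_zero.2 (by simp [smul_smul, mul_comm])).symm

theorem trivialRep_apply (ℓ : ℂ) (x : nonpos B) (r : ℂ) :
    trivialRep B ℓ x r = ℓ * centralPart B x * r := rfl

variable (B) in
/-- `V_𝔤̂(ℓ,0) = U(𝔤̂) ⊗_{U(𝔤̂_(≤0))} ℂ`. -/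
abbrev VacuumModule (ℓ : ℂ) : Type u := Induced (trivialRep B ℓ)

variable (B) in
/-- The vacuum vector `𝟏`. -/
def vacuum (ℓ : ℂ) : VacuumModule B ℓ := Induced.tmul (trivialRep B ℓ) 1 1

theorem idField_aux (v : W) : BddBelow (Function.support fun n : ℤ =>
    (if n = 0 then (1 : Module.End ℂ W) else 0) v) :=
  ⟨0, fun y hy => by by_contra h; exact hy (by simp [show y ≠ 0 by omega])⟩

variable (W) in
/-- The identity of `W` as a vertex operator. -/
def idField : VertexOperator ℂ W :=
  VertexOperator.of_coeff (fun n => if n = 0 then 1 else 0) idField_aux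

theorem idField_ncoeff (n : ℤ) (v : W) : ((idField W)[[n]]) v = if n = -1 then v else 0 := by
  rw [idField, VertexOperator.ncoeff_of_coeff]
  split_ifs with h1 h2 h2 <;> first | rfl | omega

theorem nthProduct_idField (A : VertexOperator ℂ W) (n : ℕ) :
    nthProduct A (idField W) n = 0 := by
  apply field_ext
  intro k w
  rw [nthProduct_ncoeff, nthMode]
  simp only [idField_ncoeff, map_zero, Pi.zero_apply, LinearMap.zero_apply]
  rw [sub_eq_zero]
  have hbig : ∀ i : ℕ, n < i → binCoeff n i = 0 := fun i hi => by
    rw [binCoeff, Ring.choose_natCast, Nat.choose_eq_zero_of_lt hi]; simp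
  by_cases hs : 0 ≤ (n : ℤ) + k + 1 ∧ k + 1 ≤ 0
  · obtain ⟨s, hs'⟩ := Int.eq_ofNat_of_zero_le hs.1
    obtain ⟨t, ht⟩ := Int.eq_ofNat_of_zero_le (show 0 ≤ -(k + 1) by omega)
    have hst : n = s + t := by omega
    rw [finsum_eq_single _ t, finsum_eq_single _ s]
    · rw [if_pos (by omega), if_pos (by omega), show (n : ℤ) - t = s by omega]
      congr 1
      rw [binCoeff, binCoeff, Ring.choose_natCast, Ring.choose_natCast, hst,
        Nat.choose_symm_add, ← mul_assoc]
      congr 1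
      rw [Int.negOnePow_def]
      push_cast
      rw [← Nat.cast_add, zpow_natCast]
      push_cast
      rw [← pow_add, show s + t + s = 2 * s + t by ring, pow_add, pow_mul]
      simp
    · intro i hi
      rw [if_neg (by omega), smul_zero]
    · intro i hi
      rw [if_neg (by omega), map_zero, smul_zero]
  · rw [finsum_eq_zero_of_forall_eq_zero, finsum_eq_zero_of_forall_eq_zero]
    · intro i
      split_ifs with h
      · rw [hbig i (by omega)]; simp
      · simp
    · intro i
      split_ifs with h
      · rw [hbig i (by omega)]; simp
      · simp

/-- The vertex operator map `Y_W : V_𝔤̂(ℓ,0) → Hom(W, W((x)))` of a restricted module `W` of level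
`ℓ`: the unique linear map with `Y_W(𝟏, x) = 1` and
`Y_W(a(n) v, x) = Res_{x₁} (x₁ - x) ^ n a(x₁) Y_W(v, x) - Res_{x₁} (-x + x₁) ^ n Y_W(v, x) a(x₁)`.
For `W = V_𝔤̂(ℓ,0)` it is the vertex operator map `Y` of the vertex algebra. -/
def vertexOperatorMap (hW : IsRestricted B W) {ℓ : ℂ} (hℓ : HasLevel B W ℓ) :
    VacuumModule B ℓ →ₗ[ℂ] VertexOperator ℂ W :=
  Induced.lift (trivialRep B ℓ) (action hW hℓ) (LinearMap.toSpanSingleton ℂ _ (idField W)) (by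
    rintro ⟨x, hx⟩ r
    change (ℓ * centralPart B x * r) • idField W = actionLin hW ℓ x (r • idField W)
    change x ∈ Submodule.span ℂ _ at hx
    induction hx using Submodule.span_induction with
    | mem x hx =>
      rcases hx with ⟨n, a, rfl⟩ | rfl
      · rw [map_smul, actionLin_gen, nthProduct_idField]
        simp
      · rw [actionLin_central, centralPart_central, mul_one, smul_smul]
    | zero => simp
    | add x y _ _ hx hy =>
      rw [map_add, map_add, LinearMap.add_apply, ← hx, ← hy, ← add_smul]
      congr 1; ring
    | smul c x _ hx =>
      rw [map_smul (centralPart B), map_smul (actionLin hW ℓ), LinearMap.smul_apply, ← hx,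
        smul_smul, smul_eq_mul]
      congr 1; ring)

theorem vertexOperatorMap_vacuum (hW : IsRestricted B W) {ℓ : ℂ} (hℓ : HasLevel B W ℓ) :
    vertexOperatorMap hW hℓ (vacuum B ℓ) = idField W := by
  rw [vertexOperatorMap, vacuum, Induced.lift_tmul]
  simp

theorem vertexOperatorMap_gen (hW : IsRestricted B W) {ℓ : ℂ} (hℓ : HasLevel B W ℓ)
    (n : ℤ) (a : 𝔤) (v : VacuumModule B ℓ) :
    vertexOperatorMap hW hℓ ⁅gen B n a, v⁆ =
      nthProduct (currentField B hW a) (vertexOperatorMap hW hℓ v) n := by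
  rw [vertexOperatorMap, Induced.lift_lie]
  exact actionLin_gen hW ℓ n a _

theorem vertexOperatorMap_generator (hW : IsRestricted B W) {ℓ : ℂ} (hℓ : HasLevel B W ℓ)
    (a : 𝔤) :
    vertexOperatorMap hW hℓ ⁅gen B (-1) a, vacuum B ℓ⁆ = currentField B hW a := by
  rw [vertexOperatorMap_gen, vertexOperatorMap_vacuum]
  apply field_ext
  intro k w
  rw [nthProduct_ncoeff, nthMode]
  simp only [idField_ncoeff]
  by_cases hk : k ≤ -1
  · obtain ⟨t, ht⟩ := Int.eq_ofNat_of_zero_le (show 0 ≤ -1 - k by omega)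
    rw [finsum_eq_single _ t, finsum_eq_zero_of_forall_eq_zero, sub_zero]
    · rw [if_pos (by omega), show (-1 : ℤ) - t = k by omega]
      have : binCoeff (-1) t = 1 := by
        rw [binCoeff, Ring.choose_neg]
        simp [Int.negOnePow_def, Units.smul_def, Ring.choose_natCast, ← mul_pow]
      rw [this, one_smul]
    · intro i; rw [if_neg (by omega), smul_zero]
    · intro i hi; rw [if_neg (by omega), map_zero, smul_zero]
  · obtain ⟨s, hs⟩ := Int.eq_ofNat_of_zero_le (show 0 ≤ k by omega)
    rw [finsum_eq_zero_of_forall_eq_zero, finsum_eq_single _ s, zero_sub]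
    · rw [if_pos (by omega)]
      have : binCoeff (-1) s = 1 := by
        rw [binCoeff, Ring.choose_neg]
        simp [Int.negOnePow_def, Units.smul_def, Ring.choose_natCast, ← mul_pow]
      rw [this, hs]
      simp [Int.negOnePow_def]
    · intro i hi; rw [if_neg (by omega), smul_zero]
    · intro i; rw [if_neg (by omega), map_zero, smul_zero]

end modules

section category
variable {𝔤 : Type u} [LieRing 𝔤] [LieAlgebra ℂ 𝔤] {B : InvariantForm 𝔤}
variable {M : Type v} [AddCommGroup M] [Module ℂ M]

theorem restricted_lie {W : Type w} [AddCommGroup W] [Module ℂ W] [LieRingModule (Alg B) W]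
    [LieModule ℂ (Alg B) W] (x : Alg B) (v : W)
    (hv : ∀ a : 𝔤, ∃ N : ℕ, ∀ n : ℕ, N ≤ n → ⁅gen B n a, v⁆ = 0) :
    ∀ a : 𝔤, ∃ N : ℕ, ∀ n : ℕ, N ≤ n → ⁅gen B n a, ⁅x, v⁆⁆ = 0 := by
  induction x using alg_induction with
  | hg k b =>
    intro a
    obtain ⟨N, hN⟩ := hv a
    obtain ⟨N', hN'⟩ := hv ⁅a, b⁆
    refine ⟨N + N' + 2 * k.natAbs + 1, fun n hn => ?_⟩
    have h1 : ⁅gen B ((n : ℤ) + k) ⁅a, b⁆, v⁆ = 0 := by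
      have := hN' ((n : ℤ) + k).toNat (by omega)
      rwa [Int.toNat_of_nonneg (by omega)] at this
    rw [leibniz_lie, hN n (by omega), lie_zero, add_zero, lie_gen_gen, if_neg (by omega),
      zero_smul, add_zero, h1]
  | hc =>
    intro a
    obtain ⟨N, hN⟩ := hv a
    refine ⟨N, fun n hn => ?_⟩
    rw [leibniz_lie, hN n hn, ← lie_skew, central_lie]
    simp
  | hadd x y hx hy =>
    intro a
    obtain ⟨N, hN⟩ := hx a
    obtain ⟨N', hN'⟩ := hy a
    exact ⟨max N N', fun n hn => by
      rw [add_lie x y v, lie_add, hN n (by omega), hN' n (by omega), add_zero]⟩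
  | hsmul r x hx =>
    intro a
    obtain ⟨N, hN⟩ := hx a
    exact ⟨N, fun n hn => by rw [smul_lie r x v, lie_smul, hN n hn, smul_zero]⟩

theorem Induced.isRestricted (ρ : nonpos B →ₗ⁅ℂ⁆ Module.End ℂ M)
    (hρ : ∀ (a : 𝔤) (m : M), ∃ N : ℕ, ∀ n : ℕ, N ≤ n → ρ ⟨gen B n a, gen_mem_nonpos B n a⟩ m = 0) :
    IsRestricted B (Induced ρ) := by
  intro a v
  revert a
  induction v using Induced.induction with
  | h1 m =>
    intro a
    obtain ⟨N, hN⟩ := hρ a m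
    refine ⟨N, fun n hn => ?_⟩
    have := Induced.balanced ρ 1 ⟨gen B n a, gen_mem_nonpos B n a⟩ m
    rw [hN n hn, one_mul] at this
    rw [lie_def, Induced.smul_tmul, mul_one, this, Induced.tmul_zero]
  | hadd v w hv hw =>
    intro a
    obtain ⟨N, hN⟩ := hv a
    obtain ⟨N', hN'⟩ := hw a
    exact ⟨max N N', fun n hn => by rw [lie_add, hN n (by omega), hN' n (by omega), add_zero]⟩
  | hsmul r v hv =>
    intro a
    obtain ⟨N, hN⟩ := hv a
    exact ⟨N, fun n hn => by rw [lie_smul, hN n hn, smul_zero]⟩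
  | hlie x v hv => exact restricted_lie x v hv

theorem Induced.hasLevel (ρ : nonpos B →ₗ⁅ℂ⁆ Module.End ℂ M) (ℓ : ℂ)
    (hρ : ∀ m : M, ρ ⟨central B, central_mem_nonpos B⟩ m = ℓ • m) : HasLevel B (Induced ρ) ℓ := by
  intro v
  induction v using Induced.induction with
  | h1 m =>
    have := Induced.balanced ρ 1 ⟨central B, central_mem_nonpos B⟩ m
    rw [hρ, one_mul] at this
    rw [lie_def, Induced.smul_tmul, mul_one, this, Induced.tmul_smul]
  | hadd v w hv hw => rw [lie_add, hv, hw, smul_add]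
  | hsmul r v hv => rw [lie_smul, hv, smul_comm]
  | hlie x v hv => rw [leibniz_lie, hv, central_lie, zero_lie, zero_add, lie_smul]

/-- `M` is finite-dimensional, restricted, of level `ℓ`, and `𝔤̂_(-)` acts nilpotently: the module
induced from such an `M` is a generalized Weyl module of level `ℓ`. -/
structure IsWeylDatum (ℓ : ℂ) (ρ : nonpos B →ₗ⁅ℂ⁆ Module.End ℂ M) : Prop where
  finite : Module.Finite ℂ M
  level : ∀ m : M, ρ ⟨central B, central_mem_nonpos B⟩ m = ℓ • m
  restricted : ∀ (a : 𝔤) (m : M), ∃ N : ℕ, ∀ n : ℕ, N ≤ n →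
    ρ ⟨gen B n a, gen_mem_nonpos B n a⟩ m = 0
  nilpotent : ∃ N : ℕ, ∀ x : Fin N → nonpos B, (∀ i, (x i : Alg B) ∈ negSubspace B) →
    (List.ofFn fun i => ρ (x i)).prod = 0

variable (B) in
/-- `W` is an object of `𝒪_κ`: a quotient of a generalized Weyl module of level `κ - h`.
(`M` is finite-dimensional, so there is no loss in taking it in `Type`.) -/
def IsObjectO (κ h : ℂ) (W : Type w) [AddCommGroup W] [Module ℂ W] [LieRingModule (Alg B) W]
    [LieModule ℂ (Alg B) W] : Prop :=
  ∃ (M : Type) (_ : AddCommGroup M) (_ : Module ℂ M) (ρ : nonpos B →ₗ⁅ℂ⁆ Module.End ℂ M),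
    IsWeylDatum (κ - h) ρ ∧ ∃ f : Induced ρ →ₗ⁅ℂ, Alg B⁆ W, Function.Surjective f

variable {W : Type w} [AddCommGroup W] [Module ℂ W] [LieRingModule (Alg B) W]
  [LieModule ℂ (Alg B) W]

theorem IsObjectO.isRestricted {κ h : ℂ} (hW : IsObjectO B κ h W) : IsRestricted B W := by
  obtain ⟨M, _, _, ρ, hρ, f, hf⟩ := hW
  intro a w
  obtain ⟨v, rfl⟩ := hf w
  obtain ⟨N, hN⟩ := Induced.isRestricted ρ hρ.restricted a v
  exact ⟨N, fun n hn => by rw [← LieModuleHom.map_lie, hN n hn, map_zero]⟩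

theorem IsObjectO.hasLevel {κ h : ℂ} (hW : IsObjectO B κ h W) : HasLevel B W (κ - h) := by
  obtain ⟨M, _, _, ρ, hρ, f, hf⟩ := hW
  intro w
  obtain ⟨v, rfl⟩ := hf w
  rw [← LieModuleHom.map_lie, Induced.hasLevel ρ _ hρ.level, map_smul]

end category

section conformal
variable {𝔤 : Type u} [LieRing 𝔤] [LieAlgebra ℂ 𝔤] (B : InvariantForm 𝔤)
open scoped VertexOperator

theorem vacuumModule_isRestricted (ℓ : ℂ) : IsRestricted B (VacuumModule B ℓ) :=
  Induced.isRestricted _ fun a m => ⟨0, fun n _ => by simp [trivialRep_apply]⟩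

theorem vacuumModule_hasLevel (ℓ : ℂ) : HasLevel B (VacuumModule B ℓ) ℓ :=
  Induced.hasLevel _ _ fun m => by simp [trivialRep_apply]

variable [Module.Finite ℂ 𝔤]

/-- A basis of `𝔤`. -/
def basis : Module.Basis (Fin (Module.finrank ℂ 𝔤)) ℂ 𝔤 := Module.finBasis ℂ 𝔤

/-- The basis dual to `basis` with respect to the form. The tensor `∑ i, basis i ⊗ dualBasis i`
does not depend on the basis: it equals `∑ p, c_p ⊗ c_p` for every orthonormal basis `c_p`. -/
def dualBasis : Module.Basis (Fin (Module.finrank ℂ 𝔤)) ℂ 𝔤 :=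
  B.form.dualBasis B.nondegenerate basis

/-- `h` is the dual Coxeter number of `𝔤` with respect to the form: the Casimir element acts on the
adjoint module as the scalar `2h`. -/
def IsDualCoxeterNumber (h : ℂ) : Prop :=
  ∀ a : 𝔤, ∑ i, ⁅(basis i : 𝔤), ⁅dualBasis B i, a⁆⁆ = (2 * h) • a

/-- The conformal vector `ω = (2(ℓ + h))⁻¹ ∑ i, g^i(-1) g^i(-1) 𝟏`. -/
def conformalVector (ℓ h : ℂ) : VacuumModule B ℓ :=
  (1 / (2 * (ℓ + h))) •
    ∑ i, ⁅gen B (-1) (basis i), ⁅gen B (-1) (dualBasis B i), vacuum B ℓ⁆⁆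

/-- The operator `L(0) = ω_1` on `V_𝔤̂(ℓ,0)`. -/
def L0 (ℓ h : ℂ) : Module.End ℂ (VacuumModule B ℓ) :=
  (vertexOperatorMap (vacuumModule_isRestricted B ℓ) (vacuumModule_hasLevel B ℓ)
    (conformalVector B ℓ h))[[1]]

/-- `V_+ = ∐_{n > 0} V_(n)`, where `V_(n)` is the eigenspace of `L(0)` with eigenvalue `n`. -/
def VPlus (ℓ h : ℂ) : Submodule ℂ (VacuumModule B ℓ) :=
  ⨆ n : ℕ, ⨆ _ : 0 < n, Module.End.eigenspace (L0 B ℓ h) (n : ℂ)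

end conformal

section cofinite
open scoped VertexOperator
variable {V : Type u} [AddCommGroup V] [Module ℂ V] {W : Type w} [AddCommGroup W] [Module ℂ W]

/-- `C₁(W)`: the span of the `u_{-1} w` for `u ∈ V_+` and `w ∈ W`. -/
def C1 (Vplus : Submodule ℂ V) (Y : V →ₗ[ℂ] VertexOperator ℂ W) : Submodule ℂ W :=
  Submodule.span ℂ {y | ∃ u ∈ Vplus, ∃ w : W, y = ((Y u)[[-1]]) w}

/-- `W` is `C₁`-cofinite. -/
def IsC1Cofinite (Vplus : Submodule ℂ V) (Y : V →ₗ[ℂ] VertexOperator ℂ W) : Prop :=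
  FiniteDimensional ℂ (W ⧸ C1 Vplus Y)

end cofinite

end AffineVOA
end

/-! Let `S` be the image in `W` of `1 ⊗ M`; it is finite-dimensional. Moving nonnegative modes to
the right, where they preserve `S`, shows that `W` is spanned by `S` and the vectors `a(-1-n)w` with
`n ≥ 0`. So it suffices to put every such vector into `C₁(W)`: then `S` maps onto `W/C₁(W)`.

For this take `u = a(-1-n)𝟏`. Since the field of the vacuum is the identity, `u_{-1}w = a(-1-n)w`
(`vertexOperatorMap_gen_vacuum_neg_one`). What remains is `u ∈ V_+`, and this is where the Sugawara
construction enters: `L0_gen_vacuum` computes that `u` has conformal weight `n + 1`. The operator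
`ω_1` is a normally ordered quadratic expression in the modes. On `a(-1-N)𝟏` its central terms
contribute `2(N+1)ℓ`, the zero modes contribute the Casimir eigenvalue `2h`, and the remaining
commutator terms contribute `2hN` (`two_smul_sum_genGenVacuum`). The total `2(N+1)(ℓ+h)` is divided
by `2(ℓ+h) = 2κ`, which is nonzero.

The spanning statement is `sup_eq_top_of_gen_neg_mem`. It needs no PBW theorem, only the commutation
relations and an induction over the smallest subspace that contains `S` and is stable under negative
modes. -/

noncomputable section
namespace AffineVOA
universe u v w

attribute [local instance 100] LieRing.ofAssociativeRing

/-! ### Symmetry and invariance of the Casimir tensor -/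

section casimir
variable {𝔤 : Type u} [LieRing 𝔤] [LieAlgebra ℂ 𝔤] (B : InvariantForm 𝔤) [Module.Finite ℂ 𝔤]

theorem sum_form_basis_smul_dualBasis (x : 𝔤) :
    ∑ i, B.form x (basis i) • dualBasis B i = x := by
  conv_rhs => rw [← (dualBasis B).sum_repr x]
  exact Finset.sum_congr rfl fun i _ => by
    rw [dualBasis, LinearMap.BilinForm.dualBasis_repr_apply]

theorem sum_form_dualBasis_smul_basis (x : 𝔤) :
    ∑ i, B.form x (dualBasis B i) • (basis i : 𝔤) = x := by
  conv_rhs => rw [← (basis (𝔤 := 𝔤)).sum_repr x]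
  refine Finset.sum_congr rfl fun i _ => ?_
  -- As the form is symmetric, `basis` is in turn the dual of `dualBasis`, so coordinates in `basis`
  -- are pairings with `dualBasis`.
  rw [← LinearMap.BilinForm.dualBasis_repr_apply B.nondegenerate,
    dualBasis, LinearMap.BilinForm.dualBasis_dualBasis B.nondegenerate B.symm]

variable {X : Type v} [AddCommGroup X] [Module ℂ X]

/-- Written in `basis ⊗ basis`, the Casimir tensor has as coefficients the Gram matrix of
`dualBasis`, which is symmetric. The arbitrary bilinear `F` stands in for the tensor product. -/
theorem casimir_symm (F : 𝔤 →ₗ[ℂ] 𝔤 →ₗ[ℂ] X) :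
    ∑ i, F (dualBasis B i) (basis i) = ∑ i, F (basis i) (dualBasis B i) := by
  have h1 : ∀ i, F (dualBasis B i) (basis i) =
      ∑ j, B.form (dualBasis B i) (dualBasis B j) • F (basis j) (basis i) := fun i => by
    conv_lhs => rw [← sum_form_dualBasis_smul_basis B (dualBasis B i)]
    simp
  have h2 : ∀ i, F (basis i) (dualBasis B i) =
      ∑ j, B.form (dualBasis B i) (dualBasis B j) • F (basis i) (basis j) := fun i => by
    conv_lhs => rw [← sum_form_dualBasis_smul_basis B (dualBasis B i)]
    simp
  rw [Finset.sum_congr rfl fun i _ => h1 i, Finset.sum_congr rfl fun i _ => h2 i, Finset.sum_comm]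
  exact Finset.sum_congr rfl fun i _ => Finset.sum_congr rfl fun j _ => by rw [B.symm.eq]

/-- This is the `𝔤`-invariance of the Casimir tensor. Expanding both sides in `basis ⊗ dualBasis`
reduces it to the invariance of the form. -/
theorem casimir_lie (F : 𝔤 →ₗ[ℂ] 𝔤 →ₗ[ℂ] X) (a : 𝔤) :
    ∑ i, F (basis i) ⁅dualBasis B i, a⁆ = -∑ i, F ⁅(basis i : 𝔤), a⁆ (dualBasis B i) := by
  have h1 : ∀ i, F (basis i) ⁅dualBasis B i, a⁆ =
      ∑ j, B.form ⁅dualBasis B i, a⁆ (basis j) • F (basis i) (dualBasis B j) := fun i => by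
    conv_lhs => rw [← sum_form_basis_smul_dualBasis B ⁅dualBasis B i, a⁆]
    simp
  have h2 : ∀ i, F ⁅(basis i : 𝔤), a⁆ (dualBasis B i) =
      ∑ j, B.form ⁅(basis i : 𝔤), a⁆ (dualBasis B j) • F (basis j) (dualBasis B i) := fun i => by
    conv_lhs => rw [← sum_form_dualBasis_smul_basis B ⁅(basis i : 𝔤), a⁆]
    simp
  rw [Finset.sum_congr rfl fun i _ => h1 i, Finset.sum_congr rfl fun i _ => h2 i, Finset.sum_comm,
    ← Finset.sum_neg_distrib]
  refine Finset.sum_congr rfl fun i _ => ?_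
  rw [← Finset.sum_neg_distrib]
  refine Finset.sum_congr rfl fun j _ => ?_
  rw [← neg_smul]
  congr 1
  rw [← lie_skew, map_neg, LinearMap.neg_apply, B.invariant, neg_neg, ← lie_skew, map_neg]
  congr 1
  exact B.symm.eq _ _

end casimir

/-! ### Modes acting on the vacuum module -/

section vacuum
variable {𝔤 : Type u} [LieRing 𝔤] [LieAlgebra ℂ 𝔤] (B : InvariantForm 𝔤) (ℓ h : ℂ)
open scoped VertexOperator

theorem gen_vacuum (n : ℤ) (hn : 0 ≤ n) (a : 𝔤) : ⁅gen B n a, vacuum B ℓ⁆ = 0 := by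
  lift n to ℕ using hn
  have := Induced.balanced (trivialRep B ℓ) 1 ⟨gen B n a, gen_mem_nonpos B n a⟩ 1
  rw [vacuum, lie_def, Induced.smul_tmul, mul_one]
  rw [one_mul, trivialRep_apply, centralPart_gen, mul_zero, zero_mul, Induced.tmul_zero] at this
  exact this

/-- A nonnegative mode annihilates the vacuum, so only its commutator with `b(k)` survives. -/
theorem gen_gen_vacuum (m k : ℤ) (hm : 0 ≤ m) (a b : 𝔤) :
    ⁅gen B m a, ⁅gen B k b, vacuum B ℓ⁆⁆ = ⁅gen B (m + k) ⁅a, b⁆, vacuum B ℓ⁆ +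
      (if m + k = 0 then (m : ℂ) * B.form a b * ℓ else 0) • vacuum B ℓ := by
  rw [leibniz_lie, gen_vacuum B ℓ m hm, lie_zero, add_zero, lie_gen_gen, add_lie, smul_lie,
    vacuumModule_hasLevel, smul_smul]
  congr 2
  split_ifs <;> ring

/-- The bilinear map `(x, y) ↦ x(m) y(k) 𝟏`. -/
def genGenVacuum (m k : ℤ) : 𝔤 →ₗ[ℂ] 𝔤 →ₗ[ℂ] VacuumModule B ℓ :=
  LinearMap.mk₂ ℂ (fun x y => ⁅gen B m x, ⁅gen B k y, vacuum B ℓ⁆⁆)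
    (by simp) (by simp) (by simp) (by simp)

theorem genGenVacuum_apply (m k : ℤ) (x y : 𝔤) :
    genGenVacuum B ℓ m k x y = ⁅gen B m x, ⁅gen B k y, vacuum B ℓ⁆⁆ := rfl

theorem genGenVacuum_swap (m k : ℤ) (hmk : m + k ≠ 0) (x y : 𝔤) :
    genGenVacuum B ℓ m k x y =
      genGenVacuum B ℓ k m y x + ⁅gen B (m + k) ⁅x, y⁆, vacuum B ℓ⁆ := by
  rw [genGenVacuum_apply, leibniz_lie, lie_gen_gen, if_neg hmk, zero_smul, add_zero, add_comm]
  rfl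

/-- These are the coefficients of the geometric series for `(x₁ - x)⁻¹`. -/
theorem binCoeff_neg_one (i : ℕ) : binCoeff (-1) i = 1 := by
  rw [binCoeff, Ring.choose_neg]
  simp [Int.negOnePow_def, Units.smul_def, Ring.choose_natCast, ← mul_pow]

/-- The field of `x(-1)y(-1)𝟏` is the `(-1)`-st residue product of `x(z)` and `y(z)`, that is, their
normally ordered product. The number `P` bounds the modes that act nontrivially on `v`, so both sums
are finite; the first has one term fewer because its inner mode is `y(1+i)` and not `y(i)`. -/
theorem vertexOperatorMap_gen_gen_vacuum_one {W : Type w} [AddCommGroup W] [Module ℂ W]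
    [LieRingModule (Alg B) W] [LieModule ℂ (Alg B) W] (hW : IsRestricted B W)
    (hℓ : HasLevel B W ℓ) (x y : 𝔤) (v : W) (P : ℕ)
    (hx : ∀ i : ℕ, P + 1 ≤ i → ⁅gen B i x, v⁆ = 0) (hy : ∀ i : ℕ, P < i → ⁅gen B i y, v⁆ = 0) :
    ((vertexOperatorMap hW hℓ ⁅gen B (-1) x, ⁅gen B (-1) y, vacuum B ℓ⁆⁆)[[1]]) v =
      ∑ i ∈ Finset.range P, ⁅gen B (-1 - i) x, ⁅gen B (1 + i) y, v⁆⁆ +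
      ∑ i ∈ Finset.range (P + 1), ⁅gen B (-i) y, ⁅gen B i x, v⁆⁆ := by
  rw [vertexOperatorMap_gen, vertexOperatorMap_generator, nthProduct_ncoeff,
    nthMode_eq _ _ _ _ _ P (P + 1), sub_eq_add_neg, ← Finset.sum_neg_distrib]
  · simp only [currentField_ncoeff, binCoeff_neg_one]
    simp
  · intro i hi
    rw [currentField_ncoeff]
    exact_mod_cast hy (1 + i) (by omega)
  · intro i hi
    rw [currentField_ncoeff]
    exact hx i hi

/-! ### The Sugawara computation of conformal weights -/

variable [Module.Finite ℂ 𝔤]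

/-- Exchanging the two modes produces the Casimir term `2h` for each `j`. By invariance and symmetry
of the Casimir tensor the exchanged sum is minus the same expression with the two degrees
interchanged, and `j ↦ N - 1 - j` interchanges them back. Thus the sum equals `2hN` times the vector
minus itself. -/
theorem two_smul_sum_genGenVacuum (hh : IsDualCoxeterNumber B h) (N : ℕ) (a : 𝔤) :
    (2 : ℂ) • ∑ j ∈ Finset.range N, ∑ p,
        genGenVacuum B ℓ (-1 - j) (j - N) (basis p) ⁅dualBasis B p, a⁆ =
      (N * (2 * h)) • ⁅gen B (-1 - N) a, vacuum B ℓ⁆ := by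
  have key : ∀ j ∈ Finset.range N,
      ∑ p, genGenVacuum B ℓ (-1 - j) (j - N) (basis p) ⁅dualBasis B p, a⁆ =
      (2 * h) • ⁅gen B (-1 - N) a, vacuum B ℓ⁆ -
        ∑ p, genGenVacuum B ℓ (j - N) (-1 - j) (basis p) ⁅dualBasis B p, a⁆ := by
    intro j hj
    -- The two degrees add up to `-1 - N`, which is never zero, so no central term appears.
    rw [Finset.sum_congr rfl fun p _ => genGenVacuum_swap B ℓ (-1 - j) (j - N) (by omega) _ _,
      Finset.sum_add_distrib, show (-1 - j : ℤ) + (j - N) = -1 - N by ring,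
      ← sum_lie, ← map_sum, hh a, map_smul, smul_lie, eq_sub_iff_add_eq, casimir_lie]
    have := casimir_symm B ((genGenVacuum B ℓ (j - N) (-1 - j)).compl₁₂
      (LieModule.toEnd ℂ 𝔤 𝔤 a) LinearMap.id)
    simp only [LinearMap.compl₁₂_apply, LieModule.toEnd_apply_apply, LinearMap.id_apply] at this
    simp only [← lie_skew _ a, map_neg, LinearMap.neg_apply, Finset.sum_neg_distrib, neg_neg]
      at this ⊢
    rw [this]
    abel
  have reflect : ∑ j ∈ Finset.range N, ∑ p,
        genGenVacuum B ℓ (j - N) (-1 - j) (basis p) ⁅dualBasis B p, a⁆ =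
      ∑ j ∈ Finset.range N, ∑ p,
        genGenVacuum B ℓ (-1 - j) (j - N) (basis p) ⁅dualBasis B p, a⁆ := by
    rw [← Finset.sum_range_reflect]
    refine Finset.sum_congr rfl fun j hj => ?_
    have := Finset.mem_range.1 hj
    rw [show ((N - 1 - j : ℕ) : ℤ) - N = -1 - j by omega,
      show (-1 : ℤ) - (N - 1 - j : ℕ) = j - N by omega]
  rw [two_smul]
  -- Only one of the two copies is rewritten; the other then cancels its reflected sum.
  nth_rewrite 1 [Finset.sum_congr rfl key]
  rw [Finset.sum_sub_distrib, reflect, sub_add_cancel, Finset.sum_const, Finset.card_range,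
    ← Nat.cast_smul_eq_nsmul ℂ, smul_smul]

/-- Every term of `ω_1` is evaluated directly with `gen_gen_vacuum`. The terms fall into three
kinds: central contractions, the zero modes, and the sums of `two_smul_sum_genGenVacuum`. -/
theorem L0_gen_vacuum (hh : IsDualCoxeterNumber B h) (hℓ : ℓ + h ≠ 0) (N : ℕ) (a : 𝔤) :
    L0 B ℓ h ⁅gen B (-1 - N) a, vacuum B ℓ⁆ =
      ((N + 1 : ℕ) : ℂ) • ⁅gen B (-1 - N) a, vacuum B ℓ⁆ := by
  set v := ⁅gen B (-1 - N) a, vacuum B ℓ⁆ with hv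
  have hgen : ∀ (x : 𝔤) (i : ℕ), N + 2 ≤ i → ⁅gen B i x, v⁆ = 0 := fun x i hi => by
    rw [hv, gen_gen_vacuum B ℓ _ _ (by omega), gen_vacuum B ℓ _ (by omega), if_neg (by omega),
      zero_smul, add_zero]
  have inner : ∀ p, ((vertexOperatorMap (vacuumModule_isRestricted B ℓ)
      (vacuumModule_hasLevel B ℓ)
      ⁅gen B (-1) (basis p), ⁅gen B (-1) (dualBasis B p), vacuum B ℓ⁆⁆)[[1]]) v =
      (∑ j ∈ Finset.range N,
        genGenVacuum B ℓ (-1 - j) (j - N) (basis p) ⁅dualBasis B p, a⁆) +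
      ((N + 1) * ℓ) • ⁅gen B (-1 - N) (B.form (dualBasis B p) a • (basis p : 𝔤)), vacuum B ℓ⁆ +
      ((∑ j ∈ Finset.range N,
        genGenVacuum B ℓ (-1 - j) (j - N) (dualBasis B p) ⁅(basis p : 𝔤), a⁆) +
      ⁅gen B (-1 - N) ⁅dualBasis B p, ⁅(basis p : 𝔤), a⁆⁆, vacuum B ℓ⁆ +
      ((N + 1) * ℓ) • ⁅gen B (-1 - N) (B.form (basis p) a • dualBasis B p), vacuum B ℓ⁆) := by
    intro p
    -- The cutoff is `N + 1` because the mode of that degree still contracts with `a(-1-N)` to a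
    -- central scalar. These contractions are the last terms of the two sums; the first term of the
    -- second sum is the product of zero modes.
    rw [vertexOperatorMap_gen_gen_vacuum_one _ _ _ _ _ _ _ (N + 1) (fun i hi => hgen _ i (by omega))
      (fun i hi => by exact_mod_cast hgen _ i (by omega)), Finset.sum_range_succ,
      Finset.sum_range_succ _ (N + 1), Finset.sum_range_succ' _ N]
    congr 1
    · congr 1
      · refine Finset.sum_congr rfl fun j hj => ?_
        have := Finset.mem_range.1 hj
        rw [hv, gen_gen_vacuum B ℓ _ _ (by omega), if_neg (by omega), zero_smul, add_zero,
          genGenVacuum_apply, show (1 + j + (-1 - N) : ℤ) = j - N by ring]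
      · rw [hv, gen_gen_vacuum B ℓ _ _ (by omega), if_pos (by ring), gen_vacuum B ℓ _ (by omega),
          zero_add, lie_smul, map_smul, smul_lie, smul_smul]
        congr 1
        push_cast
        ring
    · congr 1
      · congr 1
        · refine Finset.sum_congr rfl fun j hj => ?_
          have := Finset.mem_range.1 hj
          rw [hv, gen_gen_vacuum B ℓ _ _ (by omega), if_neg (by omega), zero_smul, add_zero,
            genGenVacuum_apply, show ((j + 1 : ℕ) + (-1 - N) : ℤ) = j - N by push_cast; ring,
            show (-(j + 1 : ℕ) : ℤ) = -1 - j by push_cast; ring]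
        · rw [hv, gen_gen_vacuum B ℓ _ _ (by omega), if_neg (by omega), zero_smul, add_zero,
            gen_gen_vacuum B ℓ _ _ (by omega), if_neg (by omega), zero_smul, add_zero]
          simp
      · rw [hv, gen_gen_vacuum B ℓ _ _ (by omega), if_pos (by push_cast; ring),
          gen_vacuum B ℓ _ (by omega), zero_add, lie_smul, map_smul, smul_lie, smul_smul,
          show (-(N + 1 : ℕ) : ℤ) = -1 - N by push_cast; ring]
        congr 1
        push_cast
        ring
  -- The two normally ordered halves list the dual bases in opposite order; symmetry of the Casimir
  -- tensor identifies them.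
  have hsymm : ∀ j : ℕ,
      ∑ p, genGenVacuum B ℓ (-1 - j) (j - N) (dualBasis B p) ⁅(basis p : 𝔤), a⁆ =
      ∑ p, genGenVacuum B ℓ (-1 - j) (j - N) (basis p) ⁅dualBasis B p, a⁆ := fun j => by
    have := casimir_symm B ((genGenVacuum B ℓ (-1 - j) (j - N)).compl₁₂ LinearMap.id
      (LieModule.toEnd ℂ 𝔤 𝔤 a))
    simp only [LinearMap.compl₁₂_apply, LieModule.toEnd_apply_apply, LinearMap.id_apply] at this
    simp only [← lie_skew _ a, map_neg, Finset.sum_neg_distrib, this]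
  have hcas : ∑ p, ⁅dualBasis B p, ⁅(basis p : 𝔤), a⁆⁆ = (2 * h) • a := by
    have := casimir_symm B ((LieModule.toEnd ℂ 𝔤 𝔤 : 𝔤 →ₗ[ℂ] Module.End ℂ 𝔤).compl₁₂ LinearMap.id
      (LieModule.toEnd ℂ 𝔤 𝔤 a))
    rw [← hh a]
    simp only [LinearMap.compl₁₂_apply, LieHom.coe_toLinearMap, LieModule.toEnd_apply_apply,
      LinearMap.id_apply] at this
    have e : ∀ x y : 𝔤, ⁅x, ⁅y, a⁆⁆ = -⁅x, ⁅a, y⁆⁆ := fun x y => by rw [← lie_neg, lie_skew]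
    simp only [e, Finset.sum_neg_distrib, this]
  have hform : ∀ x, B.form x a = B.form a x := fun x => B.symm.eq x a
  rw [L0, conformalVector, map_smul, map_smul, Pi.smul_apply, LinearMap.smul_apply, map_sum,
    map_sum, Finset.sum_apply, LinearMap.sum_apply, Finset.sum_congr rfl fun p _ => inner p]
  simp only [Finset.sum_add_distrib]
  rw [Finset.sum_comm, Finset.sum_comm (f := fun p (j : ℕ) =>
    genGenVacuum B ℓ (-1 - j) (j - N) (dualBasis B p) ⁅(basis p : 𝔤), a⁆),
    Finset.sum_congr rfl fun j _ => hsymm j]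
  simp only [← Finset.smul_sum, ← sum_lie, ← map_sum, hform]
  rw [hcas, sum_form_basis_smul_dualBasis, sum_form_dualBasis_smul_basis, map_smul, smul_lie, ← hv]
  have hS := two_smul_sum_genGenVacuum B ℓ h hh N a
  rw [two_smul, ← hv] at hS
  -- Here `s` is the commutator sum, `t` the central contribution `(N+1)ℓ` and `u` the Casimir
  -- contribution `2h`. The coefficients `2hN`, `(N+1)ℓ`, `2h`, `(N+1)ℓ` add up to `2(N+1)(ℓ+h)`.
  rw [show ∀ s t u : VacuumModule B ℓ, s + t + (s + u + t) = (s + s) + t + u + t by intros; abel,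
    hS, ← add_smul, ← add_smul, ← add_smul, smul_smul]
  congr 1
  field_simp
  push_cast
  ring

theorem gen_vacuum_mem_VPlus (hh : IsDualCoxeterNumber B h) (hℓ : ℓ + h ≠ 0) (N : ℕ) (a : 𝔤) :
    ⁅gen B (-1 - N) a, vacuum B ℓ⁆ ∈ VPlus B ℓ h :=
  Submodule.mem_iSup_of_mem (N + 1) <| Submodule.mem_iSup_of_mem N.succ_pos <|
    Module.End.mem_eigenspace_iff.2 (L0_gen_vacuum B ℓ h hh hℓ N a)

end vacuum
-- Spanning by negative modes and cofiniteness
section cofinite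
variable {𝔤 : Type u} [LieRing 𝔤] [LieAlgebra ℂ 𝔤] {B : InvariantForm 𝔤}
variable {W : Type w} [AddCommGroup W] [Module ℂ W] [LieRingModule (Alg B) W]
  [LieModule ℂ (Alg B) W]
open scoped VertexOperator

/-- The identity field has only the mode of index `-1`. In the residue product this leaves the term
`i = 0` of the first sum; in the second it would require `i = -1 - N`, which is negative. -/
theorem vertexOperatorMap_gen_vacuum_neg_one (hW : IsRestricted B W) {ℓ : ℂ}
    (hℓ : HasLevel B W ℓ) (N : ℕ) (a : 𝔤) (w : W) :
    ((vertexOperatorMap hW hℓ ⁅gen B (-1 - N) a, vacuum B ℓ⁆)[[-1]]) w =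
      ⁅gen B (-1 - N) a, w⁆ := by
  rw [vertexOperatorMap_gen, vertexOperatorMap_vacuum, nthProduct_ncoeff, nthMode,
    finsum_eq_single _ 0, finsum_eq_zero_of_forall_eq_zero, sub_zero]
  · simp [idField_ncoeff, currentField_ncoeff, binCoeff]
  · intro i
    rw [idField_ncoeff, if_neg (by omega), smul_zero]
  · intro i hi
    rw [idField_ncoeff, if_neg (by omega), map_zero, smul_zero]

/-- This replaces the triangular decomposition of the enveloping algebra: a subspace that is stable
under nonnegative modes and generates `W` already generates it under negative modes alone. -/
theorem sup_eq_top_of_gen_neg_mem {ℓ : ℂ} (hℓ : HasLevel B W ℓ) (S C : Submodule ℂ W)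
    (hS : ∀ (n : ℕ) (a : 𝔤), ∀ w ∈ S, ⁅gen B n a, w⁆ ∈ S)
    (hgen : ∀ T : Submodule ℂ W, S ≤ T → (∀ (x : Alg B), ∀ w ∈ T, ⁅x, w⁆ ∈ T) → T = ⊤)
    (hC : ∀ (n : ℕ) (a : 𝔤) (w : W), ⁅gen B (-1 - n) a, w⁆ ∈ C) : S ⊔ C = ⊤ := by
  let T : Submodule ℂ W :=
    sInf {T | S ≤ T ∧ ∀ (n : ℕ) (a : 𝔤), ∀ w ∈ T, ⁅gen B (-1 - n) a, w⁆ ∈ T}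
  have hST : S ≤ T := le_sInf fun _ hT => hT.1
  have hneg : ∀ (n : ℕ) (a : 𝔤), ∀ w ∈ T, ⁅gen B (-1 - n) a, w⁆ ∈ T := fun n a w hw =>
    Submodule.mem_sInf.2 fun _ hT => hT.2 n a w (Submodule.mem_sInf.1 hw _ hT)
  -- `T'` collects the vectors of `T` that nonnegative modes keep in `T`. It contains `S` and is
  -- stable under negative modes, so minimality of `T` forces `T ≤ T'`.
  let T' : Submodule ℂ W := T ⊓ ⨅ (n : ℕ) (a : 𝔤),
    T.comap (LieModule.toEnd ℂ (Alg B) W (gen B n a))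
  have hT' : ∀ w, w ∈ T' ↔ w ∈ T ∧ ∀ (n : ℕ) (a : 𝔤), ⁅gen B n a, w⁆ ∈ T := by simp [T']
  have hpos : T ≤ T' := by
    refine sInf_le ⟨fun w hw => (hT' w).2 ⟨hST hw, fun n a => hST (hS n a w hw)⟩,
      fun n a w hw => (hT' _).2 ?_⟩
    obtain ⟨hw, hw'⟩ := (hT' w).1 hw
    refine ⟨hneg n a w hw, fun m b => ?_⟩
    rw [leibniz_lie, lie_gen_gen, add_lie, smul_lie, hℓ, smul_smul]
    refine add_mem (add_mem ?_ (T.smul_mem _ hw)) (hneg n a _ (hw' m b))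
    -- The commutator is a single mode applied to `w`. If its degree is nonnegative, use `w ∈ T'`;
    -- if negative, use the stability of `T`.
    rcases le_or_gt 0 ((m : ℤ) + (-1 - n)) with hk | hk
    · rw [← Int.toNat_of_nonneg hk]
      exact hw' _ _
    · rw [show (m : ℤ) + (-1 - n) = -1 - (n - m : ℕ) by omega]
      exact hneg _ _ w hw
  have htop : T = ⊤ := hgen T hST fun x w hw => by
    induction x using alg_induction with
    | hg k a =>
      rcases le_or_gt 0 k with hk | hk
      · rw [← Int.toNat_of_nonneg hk]
        exact ((hT' w).1 (hpos hw)).2 _ _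
      · rw [show k = -1 - (-1 - k).toNat by omega]
        exact hneg _ _ w hw
    | hc => rw [hℓ]; exact T.smul_mem _ hw
    | hadd x y hx hy => rw [add_lie]; exact add_mem hx hy
    | hsmul r x hx => rw [smul_lie]; exact T.smul_mem _ hx
  -- `S ⊔ C` is one of the subspaces in the infimum defining `T`, since negative modes send all of
  -- `W` into `C`.
  exact top_le_iff.1 (htop ▸ sInf_le ⟨le_sup_left, fun n a w _ => Submodule.mem_sup_right (hC n a w)⟩)

/-- The linear map `m ↦ 1 ⊗ m` to the induced module. -/
def Induced.incl {L : Type u} [LieRing L] [LieAlgebra ℂ L] {H : LieSubalgebra ℂ L}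
    {M : Type v} [AddCommGroup M] [Module ℂ M] (ρ : H →ₗ⁅ℂ⁆ Module.End ℂ M) :
    M →ₗ[ℂ] Induced ρ where
  toFun := Induced.tmul ρ 1
  map_add' m m' := by rw [Induced.tmul, TensorProduct.tmul_add]; rfl
  map_smul' := Induced.tmul_smul ρ 1

theorem Induced.lie_incl {L : Type u} [LieRing L] [LieAlgebra ℂ L] {H : LieSubalgebra ℂ L}
    {M : Type v} [AddCommGroup M] [Module ℂ M] (ρ : H →ₗ⁅ℂ⁆ Module.End ℂ M) (x : H) (m : M) :
    ⁅(x : L), Induced.incl ρ m⁆ = Induced.incl ρ (ρ x m) := by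
  change ⁅(x : L), Induced.tmul ρ 1 m⁆ = Induced.tmul ρ 1 (ρ x m)
  rw [lie_def, Induced.smul_tmul, mul_one, ← Induced.balanced, one_mul]

/-- The witness is the image of `1 ⊗ M`: nonnegative modes preserve it because they act through `ρ`,
and it generates `W` because `1 ⊗ M` generates the induced module. It is chosen before `C`. -/
theorem IsObjectO.exists_finite_sup_eq_top {κ h : ℂ} (hW : IsObjectO B κ h W) :
    ∃ S : Submodule ℂ W, Module.Finite ℂ S ∧ ∀ C : Submodule ℂ W,
      (∀ (n : ℕ) (a : 𝔤) (w : W), ⁅gen B (-1 - n) a, w⁆ ∈ C) → S ⊔ C = ⊤ := by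
  have hℓ := hW.hasLevel
  obtain ⟨M, _, _, ρ, hρ, f, hf⟩ := hW
  have := hρ.finite
  refine ⟨LinearMap.range ((f : Induced ρ →ₗ[ℂ] W).comp (Induced.incl ρ)), inferInstance,
    fun C hC => sup_eq_top_of_gen_neg_mem hℓ _ C ?_ ?_ hC⟩
  · rintro n a _ ⟨m, rfl⟩
    refine ⟨ρ ⟨gen B n a, gen_mem_nonpos B n a⟩ m, ?_⟩
    rw [LinearMap.comp_apply, ← Induced.lie_incl]
    exact f.map_lie _ _
  · intro T hT hx
    refine Submodule.eq_top_iff'.2 fun w => ?_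
    obtain ⟨v, rfl⟩ := hf w
    induction v using Induced.induction with
    | h1 m => exact hT ⟨m, rfl⟩
    | hadd v w hv hw => rw [map_add]; exact add_mem hv hw
    | hsmul r v hv => rw [map_smul]; exact T.smul_mem _ hv
    | hlie x v hv => rw [LieModuleHom.map_lie]; exact hx x _ hv

end cofinite

end AffineVOA
end

theorem mainTheorem6 {𝔤 : Type*} [LieRing 𝔤] [LieAlgebra ℂ 𝔤] [Module.Finite ℂ 𝔤]
    [LieAlgebra.IsSemisimple ℂ 𝔤] (B : AffineVOA.InvariantForm 𝔤)
    (h : ℂ) (hh : AffineVOA.IsDualCoxeterNumber B h)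
    (κ : ℂ) (hκ : ∀ q : ℚ, 0 ≤ q → κ ≠ (q : ℂ))
    (W : Type*) [AddCommGroup W] [Module ℂ W] [LieRingModule (AffineVOA.Alg B) W]
    [LieModule ℂ (AffineVOA.Alg B) W] (hW : AffineVOA.IsObjectO B κ h W) :
    AffineVOA.IsC1Cofinite (AffineVOA.VPlus B (κ - h) h)
      (AffineVOA.vertexOperatorMap hW.isRestricted hW.hasLevel) := by
  obtain ⟨S, _, hS⟩ := hW.exists_finite_sup_eq_top
  -- The case `q = 0` makes `ℓ + h = κ` invertible; otherwise the convention `1 / 0 = 0` would turn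
  -- the conformal vector into zero.
  have hκ0 : κ - h + h ≠ 0 := by simpa using hκ 0 le_rfl
  set C := AffineVOA.C1 (AffineVOA.VPlus B (κ - h) h)
    (AffineVOA.vertexOperatorMap hW.isRestricted hW.hasLevel)
  have htop : S ⊔ C = ⊤ := hS C fun n a w => Submodule.subset_span
    ⟨_, AffineVOA.gen_vacuum_mem_VPlus B (κ - h) h hh hκ0 n a, w,
      (AffineVOA.vertexOperatorMap_gen_vacuum_neg_one _ _ n a w).symm⟩
  refine Module.Finite.of_surjective (C.mkQ.comp S.subtype) fun q => ?_
  obtain ⟨w, rfl⟩ := C.mkQ_surjective q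
  obtain ⟨s, hs, c, hc, rfl⟩ := Submodule.mem_sup.1 (htop ▸ Submodule.mem_top : w ∈ S ⊔ C)
  exact ⟨⟨s, hs⟩, by simpa using hc⟩
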